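/- There is a universal constant $C>0$ such that the following holds for every $n\ge 1$. Let $K\subset\mathbb{R}^n$ be a centrally symmetric convex body (compact, convex, with non-empty interior, $K=-K$) which is in isotropic position, i.e. $\int_K\langle x,\theta\rangle^2dx$ is the same for all $\theta\in S^{n-1}$, and which satisfies $\mathrm{Vol}(K)=\mathrm{Vol}(D_n)$, where $D_n$ is the Euclidean unit ball of $\mathbb{R}^n$. Then $$L_K\;\le\; C\,\inf\Big\{\sqrt{p_0}\;M^*_p(T(L))\ :\ K\subset L,\ L\in QL_q^n,\ T\in SL(n),\ 1\le q\le\infty,\ \tfrac1p+\tfrac1q=1\Big\},\qquad p_0=\min(p,n).$$ Here $L_K\ge 0$ is the isotropic constant of $K$: $L_K^2=\int_{\tilde K}\langle x,\theta\rangle^2dx$ for all $\theta\in S^{n-1}$, where $\tilde K$ is a linear image of $K$ which has volume $1$ and is in isotropic position. $QL_q^n$ is the class of all unit balls of $n$-dimensional quotients of the real Banach space $L_q=L_q([0,1],dx)$, each such quotient being identified with $\mathbb{R}^n$ by an arbitrary linear isomorphism. $SL(n)$ is the group of volume-preserving linear transformations of $\mathbb{R}^n$ ($|\det T|=1$). Finally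 $M^*_p(G)=M_p(G^\circ)$, where $G^\circ=\{x: |\langle x,y\rangle|\le 1\ \ \forall y\in G\}$ is the polar body and $M_p(G)=\big(\int_{S^{n-1}}\|\theta\|_G^p\,d\sigma(\theta)\big)^{1/p}$, with $\sigma$ the rotation-invariant probability measure on $S^{n-1}$ and $\|x\|_G=\inf\{t>0: x\in tG\}$ the Minkowski functional of $G$; for $p=\infty$ (that is, $q=1$), $M_\infty(G)=\max_{\theta\in S^{n-1}}\|\theta\|_G$. -/

import Mathlib

open MeasureTheory Set Metric
open scoped ENNReal

noncomputable section

namespace IsotropicSlicing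

/-- `ℝⁿ` with its standard Euclidean structure. -/
abbrev E (n : ℕ) : Type := EuclideanSpace ℝ (Fin n)

/-- A centrally symmetric convex body: a compact convex set with non-empty interior and `K = -K`. -/
structure IsSymmConvexBody {n : ℕ} (K : Set (E n)) : Prop where
  convex : Convex ℝ K
  isCompact : IsCompact K
  nonempty_interior : (interior K).Nonempty
  neg_mem : ∀ x ∈ K, -x ∈ K

/-- `K` is in isotropic position: `∫_K ⟨x, θ⟩² dx` does not depend on the unit vector `θ`. -/
def IsIsotropic {n : ℕ} (K : Set (E n)) : Prop :=
  ∃ c : ℝ, ∀ θ ∈ sphere (0 : E n) 1, ∫ x in K, (inner ℝ x θ) ^ 2 = c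

/-- The isotropic constant `L_K`: the number `ℓ ≥ 0` such that `∫_{T(K)} ⟨x, θ⟩² dx = ℓ²` for all
unit vectors `θ`, where `T(K)` is a linear image of `K` of volume one in isotropic position.
For a symmetric convex body in dimension `n ≥ 1` such a `T` exists and is unique up to a rotation
on the left, so that the set below has exactly one element, which `sInf` selects. -/
def isotropicConstant {n : ℕ} (K : Set (E n)) : ℝ :=
  sInf {ℓ : ℝ | 0 ≤ ℓ ∧ ∃ T : E n ≃ₗ[ℝ] E n, volume (T '' K) = 1 ∧
    ∀ θ ∈ sphere (0 : E n) 1, ∫ x in T '' K, (inner ℝ x θ) ^ 2 = ℓ ^ 2}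

/-- The rotation invariant probability measure `σ` on the unit sphere `S^{n-1}` (for `n ≥ 1`). -/
def sphereProb (n : ℕ) : Measure (sphere (0 : E n) 1) :=
  ((volume : Measure (E n)).toSphere univ)⁻¹ • (volume : Measure (E n)).toSphere

/-- The `p`-th mean norm `M_p(L) = (∫_{S^{n-1}} ‖θ‖_L ^ p dσ(θ)) ^ (1/p)`, where `‖·‖_L` is the
Minkowski functional of `L`; for `p = ∞` it is the (essential) supremum of `‖·‖_L` on the sphere. -/
def meanNorm {n : ℕ} (p : ℝ≥0∞) (L : Set (E n)) : ℝ :=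
  (eLpNorm (fun θ : sphere (0 : E n) 1 => gauge L (θ : E n)) p (sphereProb n)).toReal

/-- The polar body `K° = {x | |⟨y, x⟩| ≤ 1 for all y ∈ K}`. -/
def polarBody {n : ℕ} (K : Set (E n)) : Set (E n) :=
  (innerₗ (E n)).polar K

/-- The `p`-th mean width `M*_p(L) = M_p(L°)`. -/
def meanWidth {n : ℕ} (p : ℝ≥0∞) (L : Set (E n)) : ℝ :=
  meanNorm p (polarBody L)

/-- The space `L_q = L_q([0, 1], dx)` of real functions. -/
abbrev LqSpace (q : ℝ≥0∞) : Type :=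
  Lp ℝ q ((volume : Measure ℝ).restrict (Icc 0 1))

/-- The class `QL_q^n` of the (closed) unit balls of `n`-dimensional quotients of `L_q`,
`1 ≤ q ≤ ∞`: the quotient `L_q / F` by a closed subspace `F` carries the quotient norm, and is
identified with `ℝⁿ` by an arbitrary linear isomorphism. -/
def quotientBalls (q : ℝ≥0∞) (n : ℕ) : Set (Set (E n)) :=
  {L | ∃ _ : Fact (1 ≤ q), ∃ F : Submodule ℝ (LqSpace q), IsClosed (F : Set (LqSpace q)) ∧
    ∃ e : (LqSpace q ⧸ F) ≃ₗ[ℝ] E n, L = e '' closedBall (0 : LqSpace q ⧸ F) 1}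

end IsotropicSlicing

end

/-! Let m² be the average of ⟨x, θ⟩² over K, the same for all unit θ. Bringing K to volume one
scales lengths by Vol(K)^(-1/n), which is at most √n because the unit ball has volume at least
n^(-n/2). Hence L_K ≤ √n·m (`isotropicConstant_le`), and it remains to bound √n·m by a constant
times √p₀·M*_p(TL).

Put S = √(T*T). Then |Sy| = |Ty| and det S = 1, so by AM-GM the trace of S is at least n, and
isotropy gives n·m²·Vol(K) ≤ ∫_K ⟨x, Sx⟩ dx. Since K ⊆ L, the integrand is at most h_L(Sx), where
h_L is the support function of L. The dual of a quotient of L_q is a subspace of L_p, so for p < ∞,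
up to a small error, h_L(y) = (∑ |⟨f_v, y⟩|^p)^(1/p) with finitely many vectors f_v
(`exists_lp_approximation`).

For p ≤ n, Jensen moves the p-th root outside the integral. By the reverse Hölder inequality
`setIntegral_abs_inner_rpow_le`, the normalized L_p norm of ⟨·, S f_v⟩ on K is at most C·p·m·|S
f_v|. On the sphere the L_p norm of ⟨·, T f_v⟩ is at least c·√(p/n)·|T f_v|
(`ofReal_rpow_le_lintegral_sphere_abs_inner`), so ∑ |T f_v|^p is controlled by M*_p(TL). As |S f_v|
= |T f_v| and p/√(p/n) = √(pn), the outcome is n·m² ≤ C·√(pn)·m·M*_p(TL).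

For p ≥ n the spherical moment bound of order n already shows that TL lies in a ball of radius
C·M*_p(TL), and ⟨x, Sx⟩ ≤ |x|·|Tx| suffices.

The reverse Hölder inequality rests on exponential decay of the tails of linear functionals
(Borell's lemma), which comes from Brunn–Minkowski, itself derived from Prékopa–Leindler. -/

noncomputable section

namespace IsotropicSlicing

/-! ### Prékopa–Leindler and multiplicative Brunn–Minkowski -/

section BrunnMinkowski

open scoped Pointwise in
/-- The one-dimensional Brunn–Minkowski inequality for compact sets. -/
theorem volume_add_le_volume_add_of_isCompact {A B : Set ℝ} (hA : IsCompact A) (hB : IsCompact B)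
    (hA' : A.Nonempty) (hB' : B.Nonempty) : volume A + volume B ≤ volume (A + B) := by
  obtain ⟨m, hm, hmax⟩ := hA.exists_isGreatest hA'
  obtain ⟨l, hl, hmin⟩ := hB.exists_isLeast hB'
  -- Translate A by min B and B by max A: both copies lie in A + B, one to the left and one to the
  -- right of m + l, so they share at most that point.
  have h1 : volume ((fun x => l + x) '' A) = volume A := by
    rw [image_add_left]; exact measure_preimage_add _ _ _
  have h2 : volume ((fun x => m + x) '' B) = volume B := by
    rw [image_add_left]; exact measure_preimage_add _ _ _
  have hm2 : MeasurableSet ((fun x => m + x) '' B) :=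
    (hB.image (by fun_prop)).measurableSet
  have hint : volume (((fun x => l + x) '' A) ∩ ((fun x => m + x) '' B)) = 0 := by
    refine measure_mono_null (t := {m + l}) ?_ (by simp)
    rintro x ⟨⟨a, ha, rfl⟩, ⟨b, hb, hab⟩⟩
    have := hmax ha
    have := hmin hb
    simp only [mem_singleton_iff] at *
    linarith
  calc volume A + volume B
      = volume ((fun x => l + x) '' A) + volume ((fun x => m + x) '' B) := by rw [h1, h2]
    _ = volume ((fun x => l + x) '' A ∪ (fun x => m + x) '' B) := by
        rw [← measure_union_add_inter _ hm2, hint, add_zero]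
    _ ≤ volume (A + B) := by
        refine measure_mono (union_subset ?_ ?_)
        · rintro _ ⟨a, ha, rfl⟩
          exact ⟨a, ha, l, hl, add_comm _ _⟩
        · rintro _ ⟨b, hb, rfl⟩
          exact ⟨m, hm, b, hb, rfl⟩

open scoped Pointwise in
/-- The one-dimensional Brunn–Minkowski inequality for measurable sets. -/
theorem volume_add_le_volume_add {A B : Set ℝ} (hA : MeasurableSet A) (hB : MeasurableSet B)
    (hA' : A.Nonempty) (hB' : B.Nonempty) : volume A + volume B ≤ volume (A + B) := by
  obtain ⟨a, ha⟩ := hA'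
  obtain ⟨b, hb⟩ := hB'
  rw [hA.measure_eq_iSup_isCompact, hB.measure_eq_iSup_isCompact]
  simp only [iSup_and']
  refine ENNReal.biSup_add_biSup_le' ⟨∅, by simp⟩ ⟨∅, by simp⟩ ?_
  rintro S ⟨hSA, hS⟩ T ⟨hTB, hT⟩
  -- The compact approximants may be empty; adding the fixed points a and b makes them nonempty at
  -- no cost.
  calc volume S + volume T ≤ volume (insert a S) + volume (insert b T) := by
        gcongr <;> exact subset_insert _ _
    _ ≤ volume (insert a S + insert b T) :=
        volume_add_le_volume_add_of_isCompact (hS.insert a) (hT.insert b)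
          (insert_nonempty _ _) (insert_nonempty _ _)
    _ ≤ volume (A + B) :=
        measure_mono (add_subset_add (insert_subset ha hSA) (insert_subset hb hTB))

theorem lintegral_eq_setLIntegral_measure_lt_of_le_one {F : ℝ → ℝ≥0∞} (hF : Measurable F)
    (h1 : ∀ x, F x ≤ 1) :
    ∫⁻ x, F x = ∫⁻ t in Ioo (0 : ℝ) 1, volume {x | ENNReal.ofReal t < F x} := by
  have hfin : ∀ x, F x ≠ ∞ := fun x => ne_top_of_le_ne_top ENNReal.one_ne_top (h1 x)
  have e1 : ∫⁻ x, F x = ∫⁻ x, ENNReal.ofReal (F x).toReal := by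
    simp only [ENNReal.ofReal_toReal (hfin _)]
  rw [e1, lintegral_eq_lintegral_meas_lt _ (Filter.Eventually.of_forall fun x => by simp)
    hF.ennreal_toReal.aemeasurable]
  have e2 : ∀ t ∈ Ioi (0 : ℝ), volume {x | t < (F x).toReal} =
      (Ioo (0 : ℝ) 1).indicator (fun t => volume {x | ENNReal.ofReal t < F x}) t := by
    intro t ht
    by_cases h : t < 1
    · rw [indicator_of_mem (show t ∈ Ioo (0 : ℝ) 1 from ⟨ht, h⟩)]
      congr 1
      ext x
      exact (ENNReal.ofReal_lt_iff_lt_toReal (le_of_lt ht) (hfin x)).symm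
    · rw [indicator_of_notMem (fun h' => h h'.2)]
      refine measure_mono_null (t := ∅) ?_ (by simp)
      intro x hx
      have := ENNReal.toReal_mono ENNReal.one_ne_top (h1 x)
      simp only [ENNReal.toReal_one, mem_ofPred_eq] at this hx
      exact h (hx.trans_le this)
  rw [setLIntegral_congr_fun measurableSet_Ioi e2, setLIntegral_indicator measurableSet_Ioo,
    inter_eq_left.2 Ioo_subset_Ioi_self]

theorem ENNReal_geom_mean_le_arith_mean (a b : ℝ≥0∞) {s : ℝ} (h0 : 0 < s) (h1 : s < 1) :
    a ^ s * b ^ (1 - s) ≤ ENNReal.ofReal s * a + ENNReal.ofReal (1 - s) * b := by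
  have hpq : (s⁻¹).HolderConjugate (1 - s)⁻¹ := by
    refine Real.HolderConjugate.inv_inv h0 (by linarith) (by ring)
  refine (ENNReal.young_inequality _ _ hpq).trans_eq ?_
  rw [← ENNReal.rpow_mul, ← ENNReal.rpow_mul, mul_inv_cancel₀ h0.ne',
    mul_inv_cancel₀ (by linarith : (1 - s) ≠ 0), ENNReal.rpow_one, ENNReal.rpow_one,
    ENNReal.ofReal_inv_of_pos h0, ENNReal.ofReal_inv_of_pos (by linarith : 0 < 1 - s)]
  simp only [div_eq_mul_inv, inv_inv]
  ring

open scoped Pointwise in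
-- When both suprema equal 1, the level sets {F > t} and {G > t} are nonempty for every t < 1, and
-- their combination with weights s and 1 - s lies in {H > t}. One-dimensional Brunn–Minkowski at
-- each level, integrated over t, yields even the arithmetic mean of the two integrals as a lower
-- bound.
theorem prekopa_leindler_real_normalized {F G H : ℝ → ℝ≥0∞} {s : ℝ} (h0 : 0 < s) (h1 : s < 1)
    (hF : Measurable F) (hG : Measurable G) (hH : Measurable H)
    (hF1 : ∀ x, F x ≤ 1) (hG1 : ∀ x, G x ≤ 1)
    (hFs : ∀ t < 1, ∃ x, t < F x) (hGs : ∀ t < 1, ∃ x, t < G x)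
    (h : ∀ x y, F x ^ s * G y ^ (1 - s) ≤ H (s * x + (1 - s) * y)) :
    (∫⁻ x, F x) ^ s * (∫⁻ x, G x) ^ (1 - s) ≤ ∫⁻ x, H x := by
  have h1' : 0 < 1 - s := by linarith
  refine (ENNReal_geom_mean_le_arith_mean _ _ h0 h1).trans ?_
  -- H itself need not be bounded by 1; cutting it there keeps all levels t < 1.
  have hH' : ∫⁻ x, min (H x) 1 ≤ ∫⁻ x, H x := lintegral_mono fun x => min_le_left _ _
  refine le_trans ?_ hH'
  rw [lintegral_eq_setLIntegral_measure_lt_of_le_one hF hF1,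
    lintegral_eq_setLIntegral_measure_lt_of_le_one hG hG1,
    lintegral_eq_setLIntegral_measure_lt_of_le_one (hH.min measurable_const)
      (fun x => min_le_right _ _)]
  have anti : ∀ (K : ℝ → ℝ≥0∞), Measurable fun t : ℝ => volume {x | ENNReal.ofReal t < K x} := by
    intro K
    refine Antitone.measurable fun a b hab => measure_mono fun x hx => ?_
    exact lt_of_le_of_lt (ENNReal.ofReal_le_ofReal hab) hx
  rw [← lintegral_const_mul _ (anti F), ← lintegral_const_mul _ (anti G),
    ← lintegral_add_left ((anti F).const_mul _)]
  refine setLIntegral_mono (anti _) fun t ht => ?_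
  have ht1 : ENNReal.ofReal t < 1 := by
    rw [← ENNReal.ofReal_one]; exact (ENNReal.ofReal_lt_ofReal_iff one_pos).2 ht.2
  obtain ⟨x0, hx0⟩ := hFs _ ht1
  obtain ⟨y0, hy0⟩ := hGs _ ht1
  have mA : MeasurableSet {x | ENNReal.ofReal t < F x} := measurableSet_lt measurable_const hF
  have mB : MeasurableSet {x | ENNReal.ofReal t < G x} := measurableSet_lt measurable_const hG
  have e : ∀ (r : ℝ) (S : Set ℝ), 0 < r → ENNReal.ofReal r * volume S = volume (r • S) := by
    intro r S hr
    rw [Measure.addHaar_smul]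
    simp [abs_of_pos hr]
  rw [e s _ h0, e (1 - s) _ h1']
  refine (volume_add_le_volume_add (mA.const_smul₀ s) (mB.const_smul₀ _) ?_ ?_).trans
    (measure_mono ?_)
  · exact ⟨_, smul_mem_smul_set (by exact hx0)⟩
  · exact ⟨_, smul_mem_smul_set (by exact hy0)⟩
  · rintro _ ⟨_, ⟨x, hx, rfl⟩, _, ⟨y, hy, rfl⟩, rfl⟩
    simp only [mem_ofPred_eq, smul_eq_mul, lt_min_iff] at hx hy ⊢
    refine ⟨lt_of_lt_of_le ?_ (h x y), ht1⟩
    have hp : 0 < ENNReal.ofReal t := ENNReal.ofReal_pos.2 ht.1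
    calc ENNReal.ofReal t = ENNReal.ofReal t ^ s * ENNReal.ofReal t ^ (1 - s) := by
          rw [← ENNReal.rpow_add _ _ hp.ne' ENNReal.ofReal_ne_top]; simp
      _ < F x ^ s * G y ^ (1 - s) :=
          ENNReal.mul_lt_mul (ENNReal.rpow_lt_rpow hx h0) (ENNReal.rpow_lt_rpow hy h1')

/-- The inequality is homogeneous in F and in G separately, so each may be divided by its own finite
supremum; a zero supremum makes the left side vanish. -/
theorem prekopa_leindler_real_of_bounded {F G H : ℝ → ℝ≥0∞} {s : ℝ} (h0 : 0 < s) (h1 : s < 1)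
    (hF : Measurable F) (hG : Measurable G) (hH : Measurable H) {M : ℝ≥0∞} (hM : M ≠ ∞)
    (hFM : ∀ x, F x ≤ M) (hGM : ∀ x, G x ≤ M)
    (h : ∀ x y, F x ^ s * G y ^ (1 - s) ≤ H (s * x + (1 - s) * y)) :
    (∫⁻ x, F x) ^ s * (∫⁻ x, G x) ^ (1 - s) ≤ ∫⁻ x, H x := by
  have h1' : 0 < 1 - s := by linarith
  set a := ⨆ x, F x with ha
  set b := ⨆ x, G x with hb
  have hFa : ∀ x, F x ≤ a := le_iSup F
  have hGb : ∀ x, G x ≤ b := le_iSup G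
  have haT : a ≠ ∞ := ne_top_of_le_ne_top hM (iSup_le hFM)
  have hbT : b ≠ ∞ := ne_top_of_le_ne_top hM (iSup_le hGM)
  rcases eq_or_ne a 0 with ha0 | ha0
  · have : ∫⁻ x, F x = 0 := by
      rw [lintegral_eq_zero_iff hF]
      exact Filter.Eventually.of_forall fun x => le_antisymm ((hFa x).trans_eq ha0) bot_le
    rw [this, ENNReal.zero_rpow_of_pos h0, zero_mul]; exact bot_le
  rcases eq_or_ne b 0 with hb0 | hb0
  · have : ∫⁻ x, G x = 0 := by
      rw [lintegral_eq_zero_iff hG]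
      exact Filter.Eventually.of_forall fun x => le_antisymm ((hGb x).trans_eq hb0) bot_le
    rw [this, ENNReal.zero_rpow_of_pos h1', mul_zero]; exact bot_le
  have hiT : a⁻¹ ≠ ∞ := ENNReal.inv_ne_top.2 ha0
  have hjT : b⁻¹ ≠ ∞ := ENNReal.inv_ne_top.2 hb0
  have hsup : ∀ {c : ℝ≥0∞} {K : ℝ → ℝ≥0∞}, c = ⨆ x, K x → c ≠ 0 → c ≠ ∞ →
      ∀ t < 1, ∃ x, t < c⁻¹ * K x := by
    intro c K hc hc0 hcT t ht
    have : t * c < ⨆ x, K x := by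
      rw [← hc]
      calc t * c < 1 * c := by
            exact (ENNReal.mul_lt_mul_iff_left hc0 hcT).2 ht
        _ = c := one_mul c
    obtain ⟨x, hx⟩ := lt_iSup_iff.1 this
    refine ⟨x, ?_⟩
    rw [mul_comm, ← div_eq_mul_inv]
    exact (ENNReal.lt_div_iff_mul_lt (Or.inl hc0) (Or.inl hcT)).2 hx
  have key := prekopa_leindler_real_normalized (F := fun x => a⁻¹ * F x) (G := fun x => b⁻¹ * G x)
    (H := fun x => (a⁻¹ ^ s * b⁻¹ ^ (1 - s)) * H x) h0 h1 (hF.const_mul _) (hG.const_mul _)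
    (hH.const_mul _)
    (fun x => (mul_le_mul_right (hFa x) _).trans_eq (ENNReal.inv_mul_cancel ha0 haT))
    (fun x => (mul_le_mul_right (hGb x) _).trans_eq (ENNReal.inv_mul_cancel hb0 hbT))
    (hsup ha ha0 haT) (hsup hb hb0 hbT) (fun x y => by
      rw [ENNReal.mul_rpow_of_nonneg _ _ h0.le, ENNReal.mul_rpow_of_nonneg _ _ h1'.le,
        mul_mul_mul_comm]
      exact mul_le_mul_right (h x y) _)
  rw [lintegral_const_mul _ hF, lintegral_const_mul _ hG, lintegral_const_mul _ hH,
    ENNReal.mul_rpow_of_nonneg _ _ h0.le, ENNReal.mul_rpow_of_nonneg _ _ h1'.le,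
    mul_mul_mul_comm] at key
  refine (ENNReal.mul_le_mul_iff_right ?_ ?_).1 key
  · have p1 := ENNReal.rpow_pos (p := s) (ENNReal.inv_pos.2 haT) hiT
    have p2 := ENNReal.rpow_pos (p := 1 - s) (ENNReal.inv_pos.2 hbT) hjT
    exact (ENNReal.mul_pos p1.ne' p2.ne').ne'
  · exact ENNReal.mul_ne_top (ENNReal.rpow_ne_top_of_nonneg h0.le hiT)
      (ENNReal.rpow_ne_top_of_nonneg h1'.le hjT)

/-- The Prékopa–Leindler inequality on the real line. -/
theorem prekopa_leindler_real {F G H : ℝ → ℝ≥0∞} {s : ℝ} (h0 : 0 < s) (h1 : s < 1)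
    (hF : Measurable F) (hG : Measurable G) (hH : Measurable H)
    (h : ∀ x y, F x ^ s * G y ^ (1 - s) ≤ H (s * x + (1 - s) * y)) :
    (∫⁻ x, F x) ^ s * (∫⁻ x, G x) ^ (1 - s) ≤ ∫⁻ x, H x := by
  have h1' : 0 < 1 - s := by linarith
  have trunc : ∀ {K : ℝ → ℝ≥0∞}, Measurable K →
      ∫⁻ x, K x = ⨆ N : ℕ, ∫⁻ x, min (K x) N := by
    intro K hK
    rw [← lintegral_iSup (fun N => hK.min measurable_const)
      (fun i j hij x => min_le_min_left _ (by exact_mod_cast hij))]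
    congr 1
    ext x
    rw [← inf_iSup_eq, ENNReal.iSup_natCast, inf_top_eq]
  have rp : ∀ (r : ℝ) (f : ℕ → ℝ≥0∞), 0 < r → (⨆ N, f N) ^ r = ⨆ N, f N ^ r := by
    intro r f hr
    exact (ENNReal.orderIsoRpow r hr).map_iSup f
  rw [trunc hF, trunc hG, rp _ _ h0, rp _ _ h1', ENNReal.iSup_mul]
  refine iSup_le fun N => ?_
  rw [ENNReal.mul_iSup]
  refine iSup_le fun N' => ?_
  refine prekopa_leindler_real_of_bounded (M := max (N : ℝ≥0∞) N') h0 h1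
    (hF.min measurable_const) (hG.min measurable_const) hH (by simp)
    (fun x => (min_le_right _ _).trans (le_max_left _ _))
    (fun x => (min_le_right _ _).trans (le_max_right _ _)) fun x y => ?_
  refine le_trans ?_ (h x y)
  gcongr <;> exact min_le_left _ _

/-- The Prékopa–Leindler inequality in `ℝⁿ`. -/
theorem prekopa_leindler {n : ℕ} {F G H : (Fin n → ℝ) → ℝ≥0∞} {s : ℝ} (h0 : 0 < s) (h1 : s < 1)
    (hF : Measurable F) (hG : Measurable G) (hH : Measurable H)
    (h : ∀ x y, F x ^ s * G y ^ (1 - s) ≤ H (s • x + (1 - s) • y)) :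
    (∫⁻ x, F x) ^ s * (∫⁻ x, G x) ^ (1 - s) ≤ ∫⁻ x, H x := by
  induction n with
  | zero =>
    have e : ∀ K : (Fin 0 → ℝ) → ℝ≥0∞, ∫⁻ x, K x = K 0 := by
      intro K
      rw [volume_pi, Measure.pi_of_empty _ 0, lintegral_dirac]
    rw [e, e, e]
    simpa using h 0 0
  | succ n ih =>
    have mp := (volume_preserving_piFinSuccAbove (fun _ : Fin (n + 1) => ℝ) 0).symm
    have e : ∀ K : (Fin (n + 1) → ℝ) → ℝ≥0∞, Measurable K →
        ∫⁻ x, K x = ∫⁻ t : ℝ, ∫⁻ z : Fin n → ℝ,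
          K ((MeasurableEquiv.piFinSuccAbove (fun _ : Fin (n + 1) => ℝ) 0).symm (t, z)) := by
      intro K hK
      rw [← mp.lintegral_comp hK]
      rw [Measure.volume_eq_prod, lintegral_prod]
      exact (hK.comp (MeasurableEquiv.measurable _)).aemeasurable
    have mK : ∀ K : (Fin (n + 1) → ℝ) → ℝ≥0∞, Measurable K →
        Measurable (fun w : ℝ × (Fin n → ℝ) =>
          K ((MeasurableEquiv.piFinSuccAbove (fun _ : Fin (n + 1) => ℝ) 0).symm w)) :=
      fun K hK => hK.comp (MeasurableEquiv.measurable _)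
    rw [e F hF, e G hG, e H hH]
    refine prekopa_leindler_real h0 h1 (mK F hF).lintegral_prod_right'
      (mK G hG).lintegral_prod_right' (mK H hH).lintegral_prod_right' fun t u => ?_
    refine ih ((mK F hF).comp measurable_prodMk_left) ((mK G hG).comp measurable_prodMk_left)
      ((mK H hH).comp measurable_prodMk_left) fun x y => ?_
    refine (h _ _).trans_eq (congrArg H ?_)
    ext i
    refine Fin.cases ?_ (fun j => ?_) i <;>
      simp [MeasurableEquiv.piFinSuccAbove, Fin.insertNthEquiv]

/-- The multiplicative Brunn–Minkowski inequality. -/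
theorem volume_rpow_mul_volume_rpow_le {n : ℕ} {A B C : Set (E n)} {s : ℝ} (h0 : 0 < s)
    (h1 : s < 1) (hA : MeasurableSet A) (hB : MeasurableSet B) (hC : MeasurableSet C)
    (h : ∀ x ∈ A, ∀ y ∈ B, s • x + (1 - s) • y ∈ C) :
    volume A ^ s * volume B ^ (1 - s) ≤ volume C := by
  have mp := (EuclideanSpace.volume_preserving_symm_measurableEquiv_toLp (Fin n)).symm
  have e : ∀ S : Set (E n), MeasurableSet S → volume S = ∫⁻ x : Fin n → ℝ,
      S.indicator 1 (WithLp.toLp 2 x) := by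
    intro S hS
    rw [← lintegral_indicator_one hS, ← mp.lintegral_comp (measurable_one.indicator hS)]
    rfl
  have mS : ∀ S : Set (E n), MeasurableSet S →
      Measurable fun x : Fin n → ℝ => S.indicator (1 : E n → ℝ≥0∞) (WithLp.toLp 2 x) :=
    fun S hS => (measurable_one.indicator hS).comp
      (MeasurableEquiv.toLp 2 (Fin n → ℝ)).measurable
  rw [e A hA, e B hB, e C hC]
  refine prekopa_leindler h0 h1 (mS A hA) (mS B hB) (mS C hC) fun x y => ?_
  by_cases hx : WithLp.toLp 2 x ∈ A
  · by_cases hy : WithLp.toLp 2 y ∈ B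
    · have := h _ hx _ hy
      rw [indicator_of_mem hx, indicator_of_mem hy, WithLp.toLp_add, WithLp.toLp_smul,
        WithLp.toLp_smul, indicator_of_mem this]
      simp
    · rw [indicator_of_notMem hy, ENNReal.zero_rpow_of_pos (by linarith), mul_zero]
      exact bot_le
  · rw [indicator_of_notMem hx, ENNReal.zero_rpow_of_pos h0, zero_mul]
    exact bot_le

end BrunnMinkowski

/-! ### Borell's lemma and moments of linear functionals on a convex body -/

section ReverseHolder

namespace IsSymmConvexBody

variable {n : ℕ} {K : Set (E n)}

theorem measurableSet (hK : IsSymmConvexBody K) : MeasurableSet K := hK.isCompact.measurableSet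

theorem volume_ne_top (hK : IsSymmConvexBody K) : volume K ≠ ∞ := hK.isCompact.measure_ne_top

theorem volume_ne_zero (hK : IsSymmConvexBody K) : volume K ≠ 0 :=
  (Measure.measure_pos_of_nonempty_interior _ hK.nonempty_interior).ne'

theorem real_volume_pos (hK : IsSymmConvexBody K) : 0 < volume.real K :=
  ENNReal.toReal_pos hK.volume_ne_zero hK.volume_ne_top

theorem integrableOn (hK : IsSymmConvexBody K) {F : Type*} [NormedAddCommGroup F] {f : E n → F}
    (hf : Continuous f) : IntegrableOn f K volume :=
  hf.continuousOn.integrableOn_compact hK.isCompact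

end IsSymmConvexBody

variable {n : ℕ} {K : Set (E n)}

/-- Borell's lemma for linear functionals on a convex body. -/
theorem volume_inter_lt_inner_le (hK : IsSymmConvexBody K) (y : E n) {a : ℝ} (ha : 0 < a)
    (h : volume.real (K ∩ {x | a < |inner ℝ x y|}) ≤ volume.real K / 4) (k : ℕ) :
    volume.real (K ∩ {x | k * a < inner ℝ x y}) ≤ Real.exp (-(k / 2 : ℝ)) * volume.real K := by
  have hV := hK.real_volume_pos
  have hfin : ∀ S : Set (E n), volume (K ∩ S) ≠ ∞ := fun S =>
    measure_ne_top_of_subset inter_subset_left hK.volume_ne_top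
  have hC : volume.real (K ∩ {x | a < inner ℝ x y}) ≤ volume.real K / 4 := by
    refine (measureReal_mono ?_ (hfin _)).trans h
    rintro x ⟨hx, hx'⟩
    rw [mem_ofPred_eq] at hx'
    exact ⟨hx, hx'.trans_le (le_abs_self _)⟩
  have hc : Continuous fun x : E n => inner ℝ x y := by fun_prop
  rcases Nat.lt_or_ge k 2 with hk | hk
  · obtain rfl | rfl : k = 0 ∨ k = 1 := by omega
    · simp only [Nat.cast_zero, zero_mul, zero_div, neg_zero, Real.exp_zero, one_mul]
      exact measureReal_mono inter_subset_left hK.volume_ne_top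
    · simp only [Nat.cast_one, one_mul]
      refine hC.trans ?_
      have : 1 - 1 / 2 ≤ Real.exp (-(1 / 2 : ℝ)) := by
        have := Real.add_one_le_exp (-(1 / 2 : ℝ)); linarith
      nlinarith
  · have hk2 : (2 : ℝ) ≤ k := by exact_mod_cast hk
    -- This weight solves s·ka + (1 - s)·(-a) = a: mixing a point beyond level ka with one of the
    -- slab |⟨·, y⟩| ≤ a lands beyond level a. It is below 1 only for k ≥ 2.
    set s : ℝ := 2 / (k + 1) with hs
    have hs0 : 0 < s := by positivity
    have hs1 : s < 1 := by rw [hs, div_lt_one (by positivity)]; linarith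
    have hsk : s * (k + 1) = 2 := by rw [hs]; field_simp
    have mA : MeasurableSet (K ∩ {x | k * a < inner ℝ x y}) :=
      hK.measurableSet.inter (measurableSet_lt measurable_const hc.measurable)
    have mC : MeasurableSet (K ∩ {x | a < inner ℝ x y}) :=
      hK.measurableSet.inter (measurableSet_lt measurable_const hc.measurable)
    have mD : MeasurableSet {x : E n | a < |inner ℝ x y|} :=
      measurableSet_lt measurable_const hc.abs.measurable
    have BM := volume_rpow_mul_volume_rpow_le hs0 hs1 mA (hK.measurableSet.diff mD) mC (by
      rintro x ⟨hxK, hx⟩ z ⟨hzK, hz⟩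
      refine ⟨hK.convex hxK hzK hs0.le (by linarith) (by ring), ?_⟩
      simp only [mem_ofPred_eq, not_lt, inner_add_left, inner_smul_left, conj_trivial] at hx hz ⊢
      have := (abs_le.1 hz).1
      nlinarith)
    have BM' := ENNReal.toReal_mono (hfin _) BM
    rw [ENNReal.toReal_mul, ← ENNReal.toReal_rpow, ← ENNReal.toReal_rpow] at BM'
    change volume.real _ ^ s * volume.real _ ^ (1 - s) ≤ volume.real _ at BM'
    set α := volume.real (K ∩ {x | k * a < inner ℝ x y})
    set V := volume.real K
    have hβ : 3 / 4 * V ≤ volume.real (K \ {x : E n | a < |inner ℝ x y|}) := by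
      have := measureReal_inter_add_sdiff (μ := volume) (s := K) mD hK.volume_ne_top
      linarith
    have hα : 0 ≤ α := measureReal_nonneg
    have h1 : α ^ s * (3 / 4 * V) ^ (1 - s) ≤ V / 4 := by
      refine le_trans ?_ (BM'.trans hC)
      gcongr
    -- The ratio of 1/4 (beyond level a) to 3/4 (the slab). It is at most exp(-1), and raising to
    -- 1/s = (k + 1)/2 gives the decay.
    have h2 : (α / V) ^ s ≤ 1 / 3 := by
      rw [Real.div_rpow hα hV.le]
      rw [Real.mul_rpow (by norm_num) hV.le, Real.rpow_sub hV, Real.rpow_one] at h1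
      have h34 : (3 / 4 : ℝ) ≤ (3 / 4 : ℝ) ^ (1 - s) := by
        conv_lhs => rw [← Real.rpow_one (3 / 4 : ℝ)]
        exact Real.rpow_le_rpow_of_exponent_ge (by norm_num) (by norm_num) (by linarith)
      have hVs : 0 < V ^ s := Real.rpow_pos_of_pos hV _
      have hAs : 0 ≤ α ^ s := Real.rpow_nonneg hα _
      have : α ^ s / V ^ s * (3 / 4) * V ≤ 1 / 4 * V := by
        calc α ^ s / V ^ s * (3 / 4) * V ≤ α ^ s / V ^ s * (3 / 4 : ℝ) ^ (1 - s) * V := by gcongr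
          _ = α ^ s * ((3 / 4) ^ (1 - s) * (V / V ^ s)) := by ring
          _ ≤ V / 4 := h1
          _ = 1 / 4 * V := by ring
      have := le_of_mul_le_mul_right this hV
      linarith
    have h3 : α / V ≤ Real.exp (-(k / 2 : ℝ)) := by
      have e1 : α / V = ((α / V) ^ s) ^ ((k + 1) / 2 : ℝ) := by
        rw [← Real.rpow_mul (by positivity)]
        have : s * ((k + 1) / 2) = 1 := by linarith
        rw [this, Real.rpow_one]
      have e2 : (1 / 3 : ℝ) ≤ Real.exp (-1) := by
        rw [Real.exp_neg, one_div]
        have := Real.exp_one_lt_d9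
        exact inv_anti₀ (Real.exp_pos _) (by linarith)
      calc α / V = ((α / V) ^ s) ^ ((k + 1) / 2 : ℝ) := e1
        _ ≤ (Real.exp (-1)) ^ ((k + 1) / 2 : ℝ) := by
            refine Real.rpow_le_rpow (by positivity) (h2.trans e2) (by positivity)
        _ = Real.exp (-1 * ((k + 1) / 2)) := (Real.exp_mul _ _).symm
        _ ≤ _ := Real.exp_le_exp.2 (by linarith)
    rwa [div_le_iff₀ hV] at h3

theorem rpow_le_rpow_mul_exp {p x : ℝ} (hp : 0 < p) (hx : 0 ≤ x) :
    x ^ p ≤ p ^ p * Real.exp x := by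
  have h : x / p ≤ Real.exp (x / p) := by
    have := Real.add_one_le_exp (x / p); linarith
  calc x ^ p = p ^ p * (x / p) ^ p := by
        rw [← Real.mul_rpow hp.le (by positivity), mul_div_cancel₀ _ hp.ne']
    _ ≤ p ^ p * (Real.exp (x / p)) ^ p := by gcongr
    _ = p ^ p * Real.exp x := by rw [← Real.exp_mul, div_mul_cancel₀ _ hp.ne']

/-- Reverse Hölder inequality for linear functionals on a convex body. -/
theorem setIntegral_abs_inner_rpow_le (hK : IsSymmConvexBody K) (y : E n) {m p : ℝ} (hm : 0 < m)
    (hp : 1 ≤ p) (h : ∫ x in K, (inner ℝ x y) ^ 2 ≤ m ^ 2 * volume.real K) :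
    ∫ x in K, |inner ℝ x y| ^ p ≤ (128 * p * m) ^ p * volume.real K := by
  have hV := hK.real_volume_pos
  have hp0 : 0 < p := by linarith
  have hc : Continuous fun x : E n => inner ℝ x y := by fun_prop
  -- Twice the standard deviation: Markov for the square leaves at most a quarter of K beyond a.
  set a := 2 * m with ha
  have ha0 : 0 < a := by positivity
  have hmarkov : volume.real (K ∩ {x | a < |inner ℝ x y|}) ≤ volume.real K / 4 := by
    have := mul_meas_ge_le_integral_of_nonneg (μ := volume.restrict K)
      (f := fun x => (inner ℝ x y) ^ 2) (Filter.Eventually.of_forall fun x => sq_nonneg _)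
      (hK.integrableOn (by fun_prop)) (a ^ 2)
    have h2 : volume.real (K ∩ {x | a < |inner ℝ x y|}) ≤
        (volume.restrict K).real {x | a ^ 2 ≤ (inner ℝ x y) ^ 2} := by
      rw [inter_comm, ← measureReal_restrict_apply (measurableSet_lt measurable_const
        hc.abs.measurable)]
      have : IsFiniteMeasure (volume.restrict K) := ⟨by
        rw [Measure.restrict_apply_univ]; exact hK.volume_ne_top.lt_top⟩
      refine measureReal_mono fun x hx => ?_
      simp only [mem_ofPred_eq] at hx ⊢
      rw [← sq_abs (inner ℝ x y)]
      gcongr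
    have h3 : a ^ 2 * volume.real (K ∩ {x | a < |inner ℝ x y|}) ≤ m ^ 2 * volume.real K :=
      (mul_le_mul_of_nonneg_left h2 (sq_nonneg _)).trans (this.trans h)
    have : m ^ 2 * (4 * volume.real (K ∩ {x | a < |inner ℝ x y|})) ≤ m ^ 2 * volume.real K := by
      rw [ha] at h3 ⊢; linarith
    have := le_of_mul_le_mul_left this (by positivity)
    linarith
  have tail : ∀ k : ℕ, volume (K ∩ {x | k * a < |inner ℝ x y|}) ≤
      ENNReal.ofReal (2 * Real.exp (-(k / 2 : ℝ))) * volume K := by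
    intro k
    have hfin : ∀ S : Set (E n), volume (K ∩ S) ≠ ∞ := fun S =>
      measure_ne_top_of_subset inter_subset_left hK.volume_ne_top
    have t1 := volume_inter_lt_inner_le hK y ha0 hmarkov k
    have t2 := volume_inter_lt_inner_le hK (-y) ha0 (by simpa using hmarkov) k
    have hsub : K ∩ {x | k * a < |inner ℝ x y|} ⊆ (K ∩ {x | k * a < inner ℝ x y}) ∪
        (K ∩ {x | k * a < inner ℝ x (-y)}) := by
      rintro x ⟨hx, hx'⟩
      rw [mem_ofPred_eq] at hx'
      rcases lt_abs.1 hx' with h' | h'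
      · exact Or.inl ⟨hx, h'⟩
      · exact Or.inr ⟨hx, by simpa using h'⟩
    have : volume.real (K ∩ {x | k * a < |inner ℝ x y|}) ≤
        2 * Real.exp (-(k / 2 : ℝ)) * volume.real K := by
      refine (measureReal_mono hsub (measure_union_ne_top (hfin _) (hfin _))).trans ?_
      refine (measureReal_union_le _ _).trans ?_
      linarith
    rw [← ENNReal.ofReal_toReal (hfin _), ← ENNReal.ofReal_toReal hK.volume_ne_top,
      ← ENNReal.ofReal_mul (by positivity)]
    exact ENNReal.ofReal_le_ofReal this
  -- Trade the power for exp(u/4), where u = |⟨x, y⟩|/a, and bound that by the term of index ⌈u⌉ -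
  -- 1, or by the summand 1 when u = 0. The growth exp(k/4) is beaten by the tail decay exp(-k/2).
  have pointwise : ∀ x : E n, ENNReal.ofReal (|inner ℝ x y| ^ p) ≤
      ENNReal.ofReal ((4 * p * a) ^ p) * (1 + ∑' k : ℕ, ENNReal.ofReal (Real.exp ((k + 1) / 4)) *
        {x | k * a < |inner ℝ x y|}.indicator 1 x) := by
    intro x
    set u := |inner ℝ x y| / a with hu
    have hu0 : 0 ≤ u := by positivity
    have e1 : |inner ℝ x y| ^ p ≤ (4 * p * a) ^ p * Real.exp (u / 4) := by
      have := rpow_le_rpow_mul_exp hp0 (show 0 ≤ u / 4 by positivity)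
      calc |inner ℝ x y| ^ p = (4 * a) ^ p * (u / 4) ^ p := by
            rw [← Real.mul_rpow (by positivity) (by positivity)]
            congr 1
            rw [hu]; field_simp
        _ ≤ (4 * a) ^ p * (p ^ p * Real.exp (u / 4)) := by gcongr
        _ = _ := by
            rw [← mul_assoc, ← Real.mul_rpow (by positivity) (by positivity)]
            congr 2; ring
    refine (ENNReal.ofReal_le_ofReal e1).trans ?_
    rw [ENNReal.ofReal_mul (by positivity)]
    gcongr
    rcases hu0.eq_or_lt with h0 | h0
    · rw [← h0]; simp
    · obtain ⟨k, hk⟩ : ∃ k : ℕ, ⌈u⌉₊ = k + 1 :=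
        Nat.exists_eq_succ_of_ne_zero (Nat.ceil_pos.2 h0).ne'
      have hku : (k : ℝ) < u := Nat.lt_ceil.1 (by omega)
      have huk : u ≤ k + 1 := by
        have := Nat.le_ceil u; rw [hk] at this; exact_mod_cast this
      refine le_trans ?_ (le_add_left (ENNReal.le_tsum k))
      have : x ∈ {x : E n | k * a < |inner ℝ x y|} := by
        rw [hu, lt_div_iff₀ ha0] at hku; exact hku
      rw [indicator_of_mem this, Pi.one_apply, mul_one]
      exact ENNReal.ofReal_le_ofReal (Real.exp_le_exp.2 (by linarith))
  have mS : ∀ k : ℕ, MeasurableSet {x : E n | k * a < |inner ℝ x y|} := fun k =>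
    measurableSet_lt measurable_const hc.abs.measurable
  have mterm : ∀ k : ℕ, Measurable fun x : E n => ENNReal.ofReal (Real.exp ((k + 1) / 4)) *
        {x | k * a < |inner ℝ x y|}.indicator (1 : E n → ℝ≥0∞) x := fun k =>
    (measurable_one.indicator (mS k)).const_mul _
  have geom : ∑' k : ℕ, ENNReal.ofReal (Real.exp ((k + 1) / 4)) *
      ENNReal.ofReal (2 * Real.exp (-(k / 2 : ℝ))) ≤ ENNReal.ofReal 15 := by
    have e4 : (5 / 4 : ℝ) ≤ Real.exp (1 / 4) := by
      have := Real.add_one_le_exp (1 / 4 : ℝ); linarith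
    have e4' : Real.exp (1 / 4) ≤ (3 / 2 : ℝ) := by
      have h4 : Real.exp (1 / 4) ^ 4 = Real.exp 1 := by rw [← Real.exp_nat_mul]; norm_num
      by_contra hcon
      push Not at hcon
      have : (3 / 2 : ℝ) ^ 4 < Real.exp (1 / 4) ^ 4 := by gcongr
      have := Real.exp_one_lt_d9
      norm_num at *
      linarith
    have e4'' : Real.exp (-(1 / 4)) ≤ (4 / 5 : ℝ) := by
      rw [Real.exp_neg]
      calc (Real.exp (1 / 4))⁻¹ ≤ (5 / 4 : ℝ)⁻¹ := inv_anti₀ (by norm_num) e4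
        _ = 4 / 5 := by norm_num
    have hterm : ∀ k : ℕ, ENNReal.ofReal (Real.exp ((k + 1) / 4)) *
      ENNReal.ofReal (2 * Real.exp (-(k / 2 : ℝ))) ≤ ENNReal.ofReal (3 * (4 / 5 : ℝ) ^ k) := by
      intro k
      rw [← ENNReal.ofReal_mul (Real.exp_pos _).le]
      refine ENNReal.ofReal_le_ofReal ?_
      calc Real.exp ((k + 1) / 4) * (2 * Real.exp (-(k / 2 : ℝ)))
          = 2 * Real.exp (1 / 4) * Real.exp (-(1 / 4)) ^ k := by
            rw [← Real.exp_nat_mul, mul_left_comm, ← Real.exp_add, mul_assoc, ← Real.exp_add]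
            congr 2; ring
        _ ≤ 2 * (3 / 2) * (4 / 5) ^ k := by gcongr
        _ = _ := by ring
    refine (ENNReal.tsum_le_tsum hterm).trans ?_
    rw [← ENNReal.ofReal_tsum_of_nonneg (fun k => by positivity)
      ((summable_geometric_of_lt_one (by norm_num) (by norm_num)).mul_left 3), tsum_mul_left,
      tsum_geometric_of_lt_one (by norm_num) (by norm_num)]
    exact ENNReal.ofReal_le_ofReal (by norm_num)
  have main : ∫⁻ x in K, ENNReal.ofReal (|inner ℝ x y| ^ p) ≤
      ENNReal.ofReal ((128 * p * m) ^ p * volume.real K) := by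
    calc ∫⁻ x in K, ENNReal.ofReal (|inner ℝ x y| ^ p)
        ≤ ∫⁻ x in K, ENNReal.ofReal ((4 * p * a) ^ p) *
            (1 + ∑' k : ℕ, ENNReal.ofReal (Real.exp ((k + 1) / 4)) *
              {x | k * a < |inner ℝ x y|}.indicator 1 x) := lintegral_mono fun x => pointwise x
      _ = ENNReal.ofReal ((4 * p * a) ^ p) * (volume K +
            ∑' k : ℕ, ENNReal.ofReal (Real.exp ((k + 1) / 4)) *
              volume (K ∩ {x | k * a < |inner ℝ x y|})) := by
          rw [lintegral_const_mul' _ _ ENNReal.ofReal_ne_top, lintegral_add_left measurable_const,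
            lintegral_tsum fun k => (mterm k).aemeasurable, lintegral_const,
            Measure.restrict_apply_univ, one_mul]
          congr 3
          ext k
          rw [lintegral_const_mul' _ _ ENNReal.ofReal_ne_top, lintegral_indicator_one (mS k),
            Measure.restrict_apply (mS k), inter_comm]
      _ ≤ ENNReal.ofReal ((4 * p * a) ^ p) * (volume K +
            ∑' k : ℕ, ENNReal.ofReal (Real.exp ((k + 1) / 4)) *
              (ENNReal.ofReal (2 * Real.exp (-(k / 2 : ℝ))) * volume K)) := by
          gcongr with k
          exact tail k
      _ ≤ ENNReal.ofReal ((4 * p * a) ^ p) * (volume K + ENNReal.ofReal 15 * volume K) := by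
          simp only [← mul_assoc]
          rw [ENNReal.tsum_mul_right]
          gcongr
      _ = ENNReal.ofReal ((4 * p * a) ^ p * (16 * volume.real K)) := by
          rw [← ENNReal.ofReal_toReal hK.volume_ne_top, ← ENNReal.ofReal_mul (by norm_num),
            ← ENNReal.ofReal_add ENNReal.toReal_nonneg (by positivity),
            ← ENNReal.ofReal_mul (by positivity)]
          congr 2
          change volume.real K + 15 * volume.real K = _
          ring
      _ ≤ _ := by
          refine ENNReal.ofReal_le_ofReal ?_
          -- 16 = 1 + 15 collects the constant term and the series; absorbed into the p-th power it
          -- turns 4p·2m into 128pm.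
          have h16 : (16 : ℝ) ≤ 16 ^ p := by
            conv_lhs => rw [← Real.rpow_one (16 : ℝ)]
            exact Real.rpow_le_rpow_of_exponent_le (by norm_num) hp
          calc (4 * p * a) ^ p * (16 * volume.real K)
              ≤ (4 * p * a) ^ p * (16 ^ p * volume.real K) := by gcongr
            _ = (128 * p * m) ^ p * volume.real K := by
                rw [← mul_assoc, ← Real.mul_rpow (by positivity) (by norm_num), ha]
                congr 2; ring
  have hcp : Continuous fun x : E n => |inner ℝ x y| ^ p :=
    hc.abs.rpow_const fun x => Or.inr hp0.le
  rw [← ofReal_integral_eq_lintegral_ofReal (hK.integrableOn hcp)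
    (Filter.Eventually.of_forall fun x => Real.rpow_nonneg (abs_nonneg _) _)] at main
  exact (ENNReal.ofReal_le_ofReal_iff (by positivity)).1 main

end ReverseHolder

/-! ### Lower bounds for moments of linear functionals on the sphere -/

section SphereMoments

open scoped Pointwise in
/-- The cone measure comparison: the part of the ball with `|⟨z, v⟩| ≥ s` lies over the part of the
sphere with the same property. -/
theorem volume_ball_inter_le_sphereProb {n : ℕ} (hn : 1 ≤ n) (v : E n) {s : ℝ} (hs : 0 < s) :
    volume (ball (0 : E n) 1 ∩ {z | s ≤ |inner ℝ z v|}) ≤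
      sphereProb n {θ | s ≤ |inner ℝ (θ : E n) v|} * volume (ball (0 : E n) 1) := by
  have hm : MeasurableSet {θ : sphere (0 : E n) 1 | s ≤ |inner ℝ (θ : E n) v|} :=
    measurableSet_le measurable_const (by fun_prop)
  have hn0 : (n : ℝ≥0∞) ≠ 0 := by exact_mod_cast (by omega : n ≠ 0)
  have hb0 : volume (ball (0 : E n) 1) ≠ 0 := (measure_ball_pos _ _ one_pos).ne'
  have hbT : volume (ball (0 : E n) 1) ≠ ∞ := measure_ball_lt_top.ne
  rw [sphereProb, Measure.smul_apply, Measure.toSphere_apply' _ hm, Measure.toSphere_apply_univ,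
    smul_eq_mul, finrank_euclideanSpace_fin,
    ENNReal.mul_inv (Or.inl hn0) (Or.inl (ENNReal.natCast_ne_top n))]
  have e : ∀ V : ℝ≥0∞, (n : ℝ≥0∞)⁻¹ * (volume (ball (0 : E n) 1))⁻¹ * (n * V) *
      volume (ball (0 : E n) 1) = V := by
    intro V
    calc _ = ((n : ℝ≥0∞)⁻¹ * n) * ((volume (ball (0 : E n) 1))⁻¹ * volume (ball (0 : E n) 1)) * V := by
          ring
      _ = V := by
          rw [ENNReal.inv_mul_cancel hn0 (ENNReal.natCast_ne_top n), ENNReal.inv_mul_cancel hb0 hbT,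
            one_mul, one_mul]
  rw [e]
  refine measure_mono ?_
  rintro z ⟨hz1, hz2⟩
  rw [mem_ofPred_eq] at hz2
  rw [mem_ball_zero_iff] at hz1
  have hz0 : z ≠ 0 := by
    rintro rfl
    simp at hz2
    linarith
  have hzn : 0 < ‖z‖ := norm_pos_iff.2 hz0
  refine ⟨‖z‖, ⟨hzn, hz1⟩, ‖z‖⁻¹ • z, ⟨⟨‖z‖⁻¹ • z, ?_⟩, ?_, rfl⟩, ?_⟩
  · rw [mem_sphere_zero_iff_norm, norm_smul, norm_inv, norm_norm, inv_mul_cancel₀ hzn.ne']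
  · rw [mem_ofPred_eq]
    simp only [inner_smul_left, conj_trivial, abs_mul, abs_inv, abs_norm]
    refine hz2.trans (le_mul_of_one_le_left (abs_nonneg _) ((one_le_inv₀ hzn).2 hz1.le))
  · simp [smul_smul, hzn.ne']

theorem isProbabilityMeasure_sphereProb {n : ℕ} (hn : 1 ≤ n) :
    IsProbabilityMeasure (sphereProb n) := by
  refine ⟨?_⟩
  have hn0 : (n : ℝ≥0∞) ≠ 0 := by exact_mod_cast (by omega : n ≠ 0)
  rw [sphereProb, Measure.smul_apply, smul_eq_mul, Measure.toSphere_apply_univ,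
    finrank_euclideanSpace_fin]
  exact ENNReal.inv_mul_cancel (mul_ne_zero hn0 (measure_ball_pos _ _ one_pos).ne')
    (ENNReal.mul_ne_top (ENNReal.natCast_ne_top n) measure_ball_lt_top.ne)

/-- The ball of radius 1/4 centred at (3/4)v fits inside. This crude bound serves when p is
comparable to n. -/
theorem volume_ball_inter_ge_of_half {n : ℕ} {v : E n} (hv : ‖v‖ = 1) :
    ENNReal.ofReal ((1 / 4) ^ n) * volume (ball (0 : E n) 1) ≤
      volume (ball (0 : E n) 1 ∩ {z | 1 / 2 ≤ |inner ℝ z v|}) := by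
  have h := Measure.addHaar_ball_of_pos (volume : Measure (E n)) ((3 / 4 : ℝ) • v)
    (r := 1 / 4) (by norm_num)
  rw [finrank_euclideanSpace_fin] at h
  rw [← h]
  refine measure_mono fun z hz => ?_
  rw [mem_ball, dist_eq_norm] at hz
  have hvv : inner ℝ v v = 1 := by rw [real_inner_self_eq_norm_sq, hv]; norm_num
  constructor
  · rw [mem_ball_zero_iff]
    calc ‖z‖ = ‖(z - (3 / 4 : ℝ) • v) + (3 / 4 : ℝ) • v‖ := by rw [sub_add_cancel]
      _ ≤ ‖z - (3 / 4 : ℝ) • v‖ + ‖(3 / 4 : ℝ) • v‖ := norm_add_le _ _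
      _ < 1 / 4 + 3 / 4 := by
          rw [norm_smul, hv]
          norm_num
          linarith
      _ = 1 := by norm_num
  · rw [mem_ofPred_eq]
    have h1 : |inner ℝ (z - (3 / 4 : ℝ) • v) v| ≤ 1 / 4 := by
      refine (abs_real_inner_le_norm _ _).trans ?_
      rw [hv, mul_one]; exact hz.le
    rw [inner_sub_left, inner_smul_left, hvv] at h1
    simp only [conj_trivial] at h1
    have := (abs_le.1 h1).1
    exact le_trans (by linarith) (le_abs_self _)

/-- The reflection exchanging v and w preserves the ball and its volume. -/
theorem setIntegral_ball_inner_sq_eq {n : ℕ} {v w : E n} (hv : ‖v‖ = ‖w‖) :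
    ∫ x in ball (0 : E n) 1, (inner ℝ x v) ^ 2 = ∫ x in ball (0 : E n) 1, (inner ℝ x w) ^ 2 := by
  set R := (ℝ ∙ (v - w))ᗮ.reflection with hR
  have hRv : R v = w := Submodule.reflection_sub hv
  have hpre : R ⁻¹' ball (0 : E n) 1 = ball (0 : E n) 1 := by
    ext x; simp
  conv_rhs =>
    rw [← R.measurePreserving.setIntegral_preimage_emb R.toHomeomorph.measurableEmbedding, hpre]
  simp only [← hRv, LinearIsometryEquiv.inner_map_map]

theorem setIntegral_ball_inner_sq_le {n : ℕ} (hn : 1 ≤ n) {v : E n} (hv : ‖v‖ = 1) :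
    ∫ x in ball (0 : E n) 1, (inner ℝ x v) ^ 2 ≤ volume.real (ball (0 : E n) 1) / n := by
  have hn0 : (0 : ℝ) < n := by exact_mod_cast hn
  have hint : ∀ f : E n → ℝ, Continuous f → IntegrableOn f (ball (0 : E n) 1) volume := by
    intro f hf
    exact (hf.continuousOn.integrableOn_compact (isCompact_closedBall (0 : E n) 1)).mono_set
      ball_subset_closedBall
  set b := EuclideanSpace.basisFun (Fin n) ℝ
  have h1 : ∑ i : Fin n, ∫ x in ball (0 : E n) 1, (inner ℝ x (b i)) ^ 2 =
      n * ∫ x in ball (0 : E n) 1, (inner ℝ x v) ^ 2 := by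
    rw [Finset.sum_congr rfl fun i _ => setIntegral_ball_inner_sq_eq
      (show ‖b i‖ = ‖v‖ by rw [hv, b.orthonormal.1 i])]
    simp
  rw [le_div_iff₀ hn0, mul_comm, ← h1, ← integral_finsetSum _ fun i _ => hint _ (by fun_prop)]
  have h2 : ∀ x : E n, ∑ i : Fin n, (inner ℝ x (b i)) ^ 2 = ‖x‖ ^ 2 := by
    intro x
    rw [← b.sum_sq_norm_inner_left x]
    simp
  simp only [h2]
  calc ∫ x in ball (0 : E n) 1, ‖x‖ ^ 2 ≤ ∫ x in ball (0 : E n) 1, (1 : ℝ) := by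
        refine setIntegral_mono_on (hint _ (by fun_prop)) (hint _ continuous_const)
          measurableSet_ball fun x hx => ?_
        rw [mem_ball_zero_iff] at hx
        nlinarith [norm_nonneg x]
    _ = volume.real (ball (0 : E n) 1) := by simp

theorem exp_neg_two_mul_le {x : ℝ} (h0 : 0 ≤ x) (h1 : x ≤ 1 / 2) : Real.exp (-(2 * x)) ≤ 1 - x := by
  have h2 := Real.add_one_le_exp (2 * x)
  rw [Real.exp_neg, inv_le_comm₀ (Real.exp_pos _) (by linarith)]
  refine le_trans ?_ h2
  rw [inv_le_iff_one_le_mul₀ (by linarith)]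
  nlinarith

open scoped Pointwise in
-- Take the half slab W of the ball where -s/2 ≤ ⟨x, v⟩ ≤ 0, shrink it by r = √(1 - s²) and shift it
-- by sv. Because ⟨x, v⟩ ≤ 0 the result stays in the ball, and its points have ⟨z, v⟩ ≥ s/2.
-- Shrinking costs only r^n ≥ exp(-ns²) = exp(-16p).
theorem volume_ball_inter_ge_of_le {n : ℕ} {v : E n} (hv : ‖v‖ = 1) {p : ℝ} (hp : 1 ≤ p)
    (hpn : 64 * p ≤ n) :
    ENNReal.ofReal (3 / 8 * Real.exp (-(16 * p))) * volume (ball (0 : E n) 1) ≤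
      volume (ball (0 : E n) 1 ∩ {z | 2 * √(p / n) ≤ |inner ℝ z v|}) := by
  have hn0 : (0 : ℝ) < n := by linarith
  have hn : 1 ≤ n := by exact_mod_cast (by linarith : (1 : ℝ) ≤ n)
  have hvv : inner ℝ v v = 1 := by rw [real_inner_self_eq_norm_sq, hv]; norm_num
  set B := ball (0 : E n) 1 with hB
  have hBT : volume B ≠ ∞ := measure_ball_lt_top.ne
  have hfin : ∀ S : Set (E n), volume (B ∩ S) ≠ ∞ := fun S =>
    measure_ne_top_of_subset inter_subset_left hBT
  have hc : Continuous fun x : E n => inner ℝ x v := by fun_prop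
  set s := 4 * √(p / n) with hs
  have hs0 : 0 < s := by positivity
  have hs2 : s ^ 2 = 16 * p / n := by
    rw [hs, mul_pow, Real.sq_sqrt (by positivity)]; ring
  have hs4 : s ^ 2 ≤ 1 / 4 := by
    rw [hs2, div_le_iff₀ hn0]; linarith
  set r := √(1 - s ^ 2) with hr
  have hr2 : r ^ 2 = 1 - s ^ 2 := Real.sq_sqrt (by linarith)
  have hr0 : 0 < r := Real.sqrt_pos.2 (by linarith)
  have hr1 : r ≤ 1 := by nlinarith
  -- the slab close to the equator
  set W := B ∩ {x | inner ℝ x v ∈ Icc (-(s / 2)) 0} with hW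
  have mW : MeasurableSet {x : E n | inner ℝ x v ∈ Icc (-(s / 2)) 0} :=
    hc.measurable measurableSet_Icc
  -- Chebyshev with second moment at most Vol(B)/n, since (s/2)²·n = 4p ≥ 4.
  have hcheb : volume.real (B ∩ {x | s / 2 < |inner ℝ x v|}) ≤ volume.real B / 4 := by
    have h1 := mul_meas_ge_le_integral_of_nonneg (μ := volume.restrict B)
      (f := fun x => (inner ℝ x v) ^ 2) (Filter.Eventually.of_forall fun x => sq_nonneg _)
      (((by fun_prop : Continuous fun x : E n => (inner ℝ x v) ^ 2).continuousOn.integrableOn_compact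
        (isCompact_closedBall (0 : E n) 1)).mono_set ball_subset_closedBall) ((s / 2) ^ 2)
    have h2 : volume.real (B ∩ {x | s / 2 < |inner ℝ x v|}) ≤
        (volume.restrict B).real {x | (s / 2) ^ 2 ≤ (inner ℝ x v) ^ 2} := by
      rw [inter_comm, ← measureReal_restrict_apply (measurableSet_lt measurable_const
        hc.abs.measurable)]
      have : IsFiniteMeasure (volume.restrict B) := ⟨by
        rw [Measure.restrict_apply_univ]; exact hBT.lt_top⟩
      refine measureReal_mono fun x hx => ?_
      rw [mem_ofPred_eq] at hx ⊢
      rw [← sq_abs (inner ℝ x v)]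
      gcongr
    have h3 : (s / 2) ^ 2 * volume.real (B ∩ {x | s / 2 < |inner ℝ x v|}) ≤ volume.real B / n :=
      (mul_le_mul_of_nonneg_left h2 (sq_nonneg _)).trans
        (h1.trans (setIntegral_ball_inner_sq_le hn hv))
    have h4 : (s / 2) ^ 2 * n = 4 * p := by rw [div_pow, hs2]; field_simp; norm_num
    rw [le_div_iff₀ hn0] at h3
    have h5 : 4 * p * volume.real (B ∩ {x | s / 2 < |inner ℝ x v|}) ≤ volume.real B := by
      rw [← h4]; linarith
    have := measureReal_nonneg (μ := volume) (s := B ∩ {x | s / 2 < |inner ℝ x v|})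
    nlinarith
  -- The full slab has at least 3/4 of the volume and is covered by W and -W.
  have hWvol : 3 / 8 * volume.real B ≤ volume.real W := by
    have h1 := measureReal_inter_add_sdiff (μ := volume) (s := B)
      (measurableSet_lt measurable_const hc.abs.measurable : MeasurableSet {x : E n | s / 2 < |inner ℝ x v|})
      hBT
    have hsub : B \ {x | s / 2 < |inner ℝ x v|} ⊆ W ∪ -W := by
      rintro x ⟨hx, hx'⟩
      rw [mem_ofPred_eq, not_lt] at hx'
      obtain ⟨h1, h2⟩ := abs_le.1 hx'
      rcases le_total (inner ℝ x v) 0 with h | h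
      · exact Or.inl ⟨hx, h1, h⟩
      · refine Or.inr ⟨by rw [hB, mem_ball_zero_iff, norm_neg]; exact mem_ball_zero_iff.1 hx, ?_⟩
        rw [mem_ofPred_eq, inner_neg_left]
        exact ⟨by linarith, by linarith⟩
    have h2 : volume.real (-W) = volume.real W := by
      rw [measureReal_def, Measure.measure_neg, measureReal_def]
    have h3 : volume.real (B \ {x | s / 2 < |inner ℝ x v|}) ≤ volume.real W + volume.real W := by
      refine (measureReal_mono hsub (measure_union_ne_top (hfin _) ?_)).trans
        ((measureReal_union_le _ _).trans_eq (by rw [h2]))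
      rw [Measure.measure_neg]; exact hfin _
    linarith
  have himg : (fun x => s • v + x) '' (r • W) ⊆ B ∩ {z | 2 * √(p / n) ≤ |inner ℝ z v|} := by
    rintro _ ⟨_, ⟨x, ⟨hx, hx'⟩, rfl⟩, rfl⟩
    rw [mem_ofPred_eq] at hx'
    obtain ⟨h1, h2⟩ := hx'
    rw [hB, mem_ball_zero_iff] at hx
    constructor
    · rw [hB, mem_ball_zero_iff]
      have hsq : ‖s • v + r • x‖ ^ 2 = s ^ 2 + 2 * (s * (r * inner ℝ x v)) + r ^ 2 * ‖x‖ ^ 2 := by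
        rw [norm_add_sq_real, norm_smul, norm_smul, hv, inner_smul_left, inner_smul_right,
          real_inner_comm]
        simp only [conj_trivial, Real.norm_eq_abs, mul_pow, sq_abs]
        ring
      have hx2 : ‖x‖ ^ 2 < 1 := by nlinarith [norm_nonneg x]
      have h3 : s * (r * inner ℝ x v) ≤ 0 :=
        mul_nonpos_of_nonneg_of_nonpos hs0.le (mul_nonpos_of_nonneg_of_nonpos hr0.le h2)
      have h4 : r ^ 2 * ‖x‖ ^ 2 < r ^ 2 := by
        have : 0 < r ^ 2 := by positivity
        nlinarith
      have : ‖s • v + r • x‖ ^ 2 < 1 := by rw [hsq]; linarith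
      nlinarith [norm_nonneg (s • v + r • x)]
    · rw [mem_ofPred_eq]
      refine le_trans ?_ (le_abs_self _)
      simp only [inner_add_left, inner_smul_left, hvv, conj_trivial]
      have : r * (s / 2) ≤ s / 2 := mul_le_of_le_one_left (by positivity) hr1
      have h5 : r * (-(s / 2)) ≤ r * inner ℝ x v := mul_le_mul_of_nonneg_left h1 hr0.le
      have h6 : 2 * √(p / n) = s / 2 := by rw [hs]; ring
      linarith
  have hrn : Real.exp (-(16 * p)) ≤ r ^ n := by
    have h1 : Real.exp (-(s ^ 2)) ≤ r := by
      refine Real.le_sqrt_of_sq_le ?_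
      rw [← Real.exp_nat_mul]
      refine le_trans (le_of_eq ?_) (exp_neg_two_mul_le (sq_nonneg s) (by linarith))
      congr 1; push_cast; ring
    calc Real.exp (-(16 * p)) = Real.exp (-(s ^ 2)) ^ n := by
          rw [← Real.exp_nat_mul, hs2]; congr 1; field_simp
      _ ≤ r ^ n := by gcongr
  refine le_trans ?_ (measure_mono himg)
  rw [image_add_left, measure_preimage_add, Measure.addHaar_smul, finrank_euclideanSpace_fin,
    abs_of_pos (by positivity), ← ENNReal.ofReal_toReal hBT,
    ← ENNReal.ofReal_toReal (hfin {x | inner ℝ x v ∈ Icc (-(s / 2)) 0}),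
    ← ENNReal.ofReal_mul (by positivity), ← ENNReal.ofReal_mul (by positivity)]
  refine ENNReal.ofReal_le_ofReal ?_
  change _ * volume.real B ≤ _ * volume.real W
  calc 3 / 8 * Real.exp (-(16 * p)) * volume.real B
      = Real.exp (-(16 * p)) * (3 / 8 * volume.real B) := by ring
    _ ≤ r ^ n * volume.real W := by
        gcongr

/-- Lower bound for the `p`-th absolute moment of a linear functional on the sphere. -/
theorem ofReal_rpow_le_lintegral_sphere_abs_inner {n : ℕ} (hn : 1 ≤ n) (v : E n) {p : ℝ}
    (hp : 1 ≤ p) (hpn : p ≤ n) :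
    ENNReal.ofReal (((1 / 4) ^ 65 * √(p / n) * ‖v‖) ^ p) ≤
      ∫⁻ θ, ENNReal.ofReal (|inner ℝ (θ : E n) v| ^ p) ∂(sphereProb n) := by
  have hp0 : 0 < p := by linarith
  have hn0 : (0 : ℝ) < n := by linarith
  rcases eq_or_ne v 0 with rfl | hv0
  · simp [Real.zero_rpow hp0.ne']
  have hvn : 0 < ‖v‖ := norm_pos_iff.2 hv0
  set u := ‖v‖⁻¹ • v with hu
  have hu1 : ‖u‖ = 1 := by rw [hu, norm_smul, norm_inv, norm_norm, inv_mul_cancel₀ hvn.ne']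
  have hvu : v = ‖v‖ • u := by rw [hu, smul_smul, mul_inv_cancel₀ hvn.ne', one_smul]
  have hb0 : volume (ball (0 : E n) 1) ≠ 0 := (measure_ball_pos _ _ one_pos).ne'
  have hbT : volume (ball (0 : E n) 1) ≠ ∞ := measure_ball_lt_top.ne
  have key : ∀ (s c : ℝ), 0 < s → 0 ≤ c →
      ENNReal.ofReal c * volume (ball (0 : E n) 1) ≤
        volume (ball (0 : E n) 1 ∩ {z | s ≤ |inner ℝ z u|}) →
      ENNReal.ofReal ((s * ‖v‖) ^ p * c) ≤
        ∫⁻ θ, ENNReal.ofReal (|inner ℝ (θ : E n) v| ^ p) ∂(sphereProb n) := by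
    intro s c hs hc h
    have h1 := h.trans (volume_ball_inter_le_sphereProb hn u hs)
    have h2 := (ENNReal.mul_le_mul_iff_left hb0 hbT).1 h1
    rw [ENNReal.ofReal_mul (by positivity)]
    have hmeas : Measurable fun θ : sphere (0 : E n) 1 =>
        ENNReal.ofReal (|inner ℝ (θ : E n) v| ^ p) := by fun_prop
    refine le_trans ?_ (mul_meas_ge_le_lintegral hmeas (ENNReal.ofReal ((s * ‖v‖) ^ p)))
    refine mul_le_mul_right (h2.trans (measure_mono fun θ hθ => ?_)) _
    rw [mem_ofPred_eq] at hθ ⊢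
    refine ENNReal.ofReal_le_ofReal ?_
    refine Real.rpow_le_rpow (by positivity) ?_ hp0.le
    conv_rhs => rw [hvu]
    rw [inner_smul_right, abs_mul, abs_norm, mul_comm]
    gcongr
  have one_le : (3 / 8 : ℝ) ^ p ≤ 3 / 8 := by
    conv_rhs => rw [← Real.rpow_one (3 / 8 : ℝ)]
    exact Real.rpow_le_rpow_of_exponent_ge (by norm_num) (by norm_num) hp
  -- For 64p ≤ n the shifted slab gives the factor √(p/n). Otherwise that factor is bounded by 1,
  -- and the loss 4^(-n) is at least (4^(-64))^p; with the level 1/2 this explains the exponent 65.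
  rcases le_or_gt (64 * p) n with h | h
  · refine le_trans (ENNReal.ofReal_le_ofReal ?_)
      (key _ _ (by positivity) (by positivity) (volume_ball_inter_ge_of_le hu1 hp h))
    have e1 : Real.exp (-(16 * p)) = (Real.exp (-16)) ^ p := by
      rw [← Real.exp_mul]; congr 1; ring
    have e2 : (1 / 4 : ℝ) ^ 16 ≤ Real.exp (-16) := by
      have : (1 / 4 : ℝ) ≤ Real.exp (-1) := by
        rw [Real.exp_neg, one_div]
        have := Real.exp_one_lt_d9
        exact inv_anti₀ (Real.exp_pos _) (by linarith)
      calc (1 / 4 : ℝ) ^ 16 ≤ Real.exp (-1) ^ 16 := by gcongr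
        _ = Real.exp (-16) := by rw [← Real.exp_nat_mul]; norm_num
    calc ((1 / 4) ^ 65 * √(p / n) * ‖v‖) ^ p
        ≤ ((2 * √(p / n) * ‖v‖) * ((3 / 8) * (1 / 4) ^ 16)) ^ p := by
          refine Real.rpow_le_rpow (by positivity) ?_ hp0.le
          have : 0 ≤ √(p / n) * ‖v‖ := by positivity
          generalize √(p / n) = t at this ⊢
          norm_num
          linarith
      _ = (2 * √(p / n) * ‖v‖) ^ p * ((3 / 8) ^ p * ((1 / 4) ^ 16) ^ p) := by
          rw [Real.mul_rpow (by positivity) (by positivity),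
            Real.mul_rpow (x := 3 / 8) (by positivity) (by positivity)]
      _ ≤ _ := by
          rw [e1]
          gcongr
  · refine le_trans (ENNReal.ofReal_le_ofReal ?_)
      (key _ _ (by positivity) (by positivity) (volume_ball_inter_ge_of_half hu1))
    have e3 : ((1 / 4 : ℝ) ^ 64) ^ p ≤ (1 / 4) ^ n := by
      rw [← Real.rpow_natCast (1 / 4 : ℝ) 64, ← Real.rpow_mul (by norm_num),
        ← Real.rpow_natCast (1 / 4 : ℝ) n]
      exact Real.rpow_le_rpow_of_exponent_ge (by norm_num) (by norm_num) (by push_cast; linarith)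
    have e4 : √(p / n) ≤ 1 := Real.sqrt_le_one.2 ((div_le_one hn0).2 hpn)
    calc ((1 / 4) ^ 65 * √(p / n) * ‖v‖) ^ p
        ≤ ((1 / 2 * ‖v‖) * (1 / 4) ^ 64) ^ p := by
          refine Real.rpow_le_rpow (by positivity) ?_ hp0.le
          have : √(p / n) * ‖v‖ ≤ ‖v‖ := mul_le_of_le_one_left hvn.le e4
          generalize √(p / n) = t at this ⊢
          norm_num
          linarith
      _ = (1 / 2 * ‖v‖) ^ p * ((1 / 4) ^ 64) ^ p := by
          rw [Real.mul_rpow (by positivity) (by positivity)]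
      _ ≤ _ := by gcongr

end SphereMoments

/-! ### Quotients of L_q: reduction to finite measure spaces and duality -/

section Discretization

section FiniteLp

variable {R : Type} [Fintype R] [MeasurableSpace R] [MeasurableSingletonClass R] {ν : Measure R}
  [IsFiniteMeasure ν] {q : ℝ≥0∞}

theorem memLp_of_fintype (q : ℝ≥0∞) (ν : Measure R) [IsFiniteMeasure ν] (a : R → ℝ) :
    MemLp a q ν :=
  MemLp.of_bound (Measurable.of_discrete.aestronglyMeasurable) (∑ v, |a v|)
    (Filter.Eventually.of_forall fun v =>
      Finset.single_le_sum (f := fun v => |a v|) (fun _ _ => abs_nonneg _) (Finset.mem_univ v))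

/-- The linear map sending a function on a finite measure space to its class in `L_q`. -/
def fintypeToLp (q : ℝ≥0∞) (ν : Measure R) [IsFiniteMeasure ν] : (R → ℝ) →ₗ[ℝ] Lp ℝ q ν where
  toFun a := (memLp_of_fintype q ν a).toLp a
  map_add' _ _ := rfl
  map_smul' _ _ := rfl

theorem norm_fintypeToLp_rpow [Fact (1 ≤ q)] (hq : q ≠ ∞) (a : R → ℝ) :
    ‖fintypeToLp q ν a‖ ^ q.toReal = ∑ v, ν.real {v} * |a v| ^ q.toReal := by
  have hq1 : 1 ≤ q := Fact.out
  have hq0 : q ≠ 0 := (zero_lt_one.trans_le hq1).ne'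
  have hqr : 0 < q.toReal := ENNReal.toReal_pos hq0 hq
  change ‖(memLp_of_fintype q ν a).toLp a‖ ^ q.toReal = _
  rw [Lp.norm_toLp, eLpNorm_eq_lintegral_rpow_enorm_toReal hq0 hq, ENNReal.toReal_rpow,
    ← ENNReal.rpow_mul, one_div, inv_mul_cancel₀ hqr.ne', ENNReal.rpow_one, lintegral_fintype,
    ENNReal.toReal_sum]
  · refine Finset.sum_congr rfl fun v _ => ?_
    rw [ENNReal.toReal_mul, ← ENNReal.toReal_rpow, mul_comm, toReal_enorm, Real.norm_eq_abs]
    rfl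
  · intro v _
    exact ENNReal.mul_ne_top (ENNReal.rpow_ne_top_of_nonneg hqr.le enorm_ne_top)
      (measure_ne_top _ _)

theorem norm_fintypeToLp_top_le [Fact ((1 : ℝ≥0∞) ≤ ∞)] {a : R → ℝ} {c : ℝ} (hc : 0 ≤ c)
    (ha : ∀ v, |a v| ≤ c) : ‖fintypeToLp ∞ ν a‖ ≤ c := by
  have h := (memLp_of_fintype ∞ ν a).coeFn_toLp
  have := Lp.norm_le_of_ae_bound (f := fintypeToLp ∞ ν a) hc (by
    filter_upwards [h] with v hv
    change ‖((memLp_of_fintype ∞ ν a).toLp a : R → ℝ) v‖ ≤ c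
    rw [hv]; exact ha v)
  simpa using this

theorem fintypeToLp_congr {a b : R → ℝ} (h : ∀ v, ν {v} ≠ 0 → a v = b v) :
    fintypeToLp q ν a = fintypeToLp q ν b := by
  refine (MemLp.toLp_eq_toLp_iff (memLp_of_fintype q ν a) (memLp_of_fintype q ν b)).2 ?_
  rw [Filter.EventuallyEq, ae_iff_of_countable]
  exact h

theorem abs_le_norm_fintypeToLp_top (a : R → ℝ) {v : R} (hv : ν {v} ≠ 0) :
    |a v| ≤ ‖fintypeToLp ∞ ν a‖ := by
  change _ ≤ ‖(memLp_of_fintype ∞ ν a).toLp a‖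
  rw [Lp.norm_toLp, eLpNorm_exponent_top]
  have h := ae_le_eLpNormEssSup (f := a) (μ := ν)
  rw [ae_iff_of_countable] at h
  have h2 := ENNReal.toReal_mono (by
    rw [← eLpNorm_exponent_top]; exact (memLp_of_fintype ∞ ν a).eLpNorm_ne_top) (h v hv)
  simpa using h2

/-- Finite-dimensional duality: the support function of the image of the unit ball of `L_q` of a
finite measure space is an `ℓ_p`-sum of absolute values of linear functionals. -/
theorem exists_lp_representation {n : ℕ} [Fact (1 ≤ q)] {p : ℝ≥0∞} (hpq : 1 / p + 1 / q = 1)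
    (hp : p ≠ ∞) (u : Lp ℝ q ν →ₗ[ℝ] E n) :
    ∃ f : R → E n, ∀ y : E n,
      (∃ a : R → ℝ, ‖fintypeToLp q ν a‖ ≤ 1 ∧
        inner ℝ (u (fintypeToLp q ν a)) y = (∑ v, |inner ℝ (f v) y| ^ p.toReal) ^ (1 / p.toReal)) ∧
      (∀ a : R → ℝ, ‖fintypeToLp q ν a‖ ≤ 1 →
        inner ℝ (u (fintypeToLp q ν a)) y ≤ (∑ v, |inner ℝ (f v) y| ^ p.toReal) ^ (1 / p.toReal)) := by
  classical
  -- Images of the atoms' indicator functions. Atoms of measure zero give the zero vector.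
  set w : R → E n := fun v => u (fintypeToLp q ν (fun j => if v = j then 1 else 0)) with hw
  have hu : ∀ (a : R → ℝ) (y : E n), inner ℝ (u (fintypeToLp q ν a)) y = ∑ v, a v * inner ℝ (w v) y := by
    intro a y
    have := LinearMap.pi_apply_eq_sum_univ (u ∘ₗ fintypeToLp q ν) a
    simp only [LinearMap.comp_apply] at this
    rw [this, sum_inner]
    simp only [inner_smul_left, conj_trivial, hw]
  have hw0 : ∀ v, ν {v} = 0 → w v = 0 := by
    intro v hv
    rw [hw]
    simp only
    rw [fintypeToLp_congr (b := 0), map_zero, map_zero]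
    intro j hj
    rw [if_neg (fun h : v = j => hj (h ▸ hv)), Pi.zero_apply]
  rcases eq_or_ne q ∞ with rfl | hqT
  · have hp1 : p = 1 := by simpa using hpq
    subst hp1
    refine ⟨w, fun y => ⟨⟨fun v => SignType.sign (inner ℝ (w v) y), ?_, ?_⟩, fun a ha => ?_⟩⟩
    · refine norm_fintypeToLp_top_le zero_le_one fun v => ?_
      cases SignType.sign (inner ℝ (w v) y) <;> simp
    · rw [hu]
      simp [sign_mul_self]
    · rw [hu]
      simp only [ENNReal.toReal_one, Real.rpow_one, div_one]
      refine Finset.sum_le_sum fun v _ => ?_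
      by_cases hv : ν {v} = 0
      · rw [hw0 v hv]; simp
      · refine (le_abs_self _).trans ?_
        rw [abs_mul]
        exact mul_le_of_le_one_left (abs_nonneg _) ((abs_le_norm_fintypeToLp_top a hv).trans ha)
  · have hq1 : 1 ≤ q := Fact.out
    have hq0 : q ≠ 0 := (zero_lt_one.trans_le hq1).ne'
    have hqr : 0 < q.toReal := ENNReal.toReal_pos hq0 hqT
    have hp0 : p ≠ 0 := by rintro rfl; simp at hpq
    have hpr : 0 < p.toReal := ENNReal.toReal_pos hp0 hp
    have hconj : p.toReal.HolderConjugate q.toReal := by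
      refine ⟨?_, hpr, hqr⟩
      have := congrArg ENNReal.toReal hpq
      rw [ENNReal.toReal_add (by simp [hp0]) (by simp [hq0])] at this
      simpa using this
    -- Multiplication by m turns the weighted L_q norm into the plain ℓ_q norm, so the representing
    -- vectors become w v / m v. At null atoms m v = 0, harmless since w v = 0.
    set m : R → ℝ := fun v => ν.real {v} ^ (1 / q.toReal) with hm
    have hm0 : ∀ v, ν {v} ≠ 0 → 0 < m v := fun v hv =>
      Real.rpow_pos_of_pos (ENNReal.toReal_pos hv (measure_ne_top _ _)) _
    have hmn : ∀ v, 0 ≤ m v := fun v => Real.rpow_nonneg measureReal_nonneg _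
    have hmq : ∀ v, m v ^ q.toReal = ν.real {v} := fun v => by
      rw [hm]
      simp only
      rw [← Real.rpow_mul measureReal_nonneg, one_div, inv_mul_cancel₀ hqr.ne', Real.rpow_one]
    have hnorm : ∀ a : R → ℝ, ‖fintypeToLp q ν a‖ ≤ 1 ↔ ∑ v, |m v * a v| ^ q.toReal ≤ 1 := by
      intro a
      rw [← Real.rpow_le_rpow_iff (norm_nonneg _) zero_le_one hqr, Real.one_rpow,
        norm_fintypeToLp_rpow hqT]
      simp only [abs_mul, abs_of_nonneg (hmn _), Real.mul_rpow (hmn _) (abs_nonneg _), hmq]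
    refine ⟨fun v => (m v)⁻¹ • w v, fun y => ⟨?_, fun a ha => ?_⟩⟩
    · obtain ⟨⟨g, hg, hgs⟩, -⟩ := NNReal.isGreatest_Lp Finset.univ
        (fun v => Real.nnabs (inner ℝ ((m v)⁻¹ • w v) y)) hconj
      refine ⟨fun v => SignType.sign (inner ℝ (w v) y) * ((m v)⁻¹ * g v), ?_, ?_⟩
      · rw [hnorm]
        refine le_trans (Finset.sum_le_sum (g := fun v => (g v : ℝ) ^ q.toReal) fun v _ => ?_)
          (by exact_mod_cast hg)
        refine Real.rpow_le_rpow (abs_nonneg _) ?_ hqr.le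
        rw [abs_mul, abs_mul, abs_mul, abs_inv, abs_of_nonneg (hmn v), NNReal.abs_eq]
        have h1 : |((SignType.sign (inner ℝ (w v) y) : SignType) : ℝ)| ≤ 1 := by
          cases SignType.sign (inner ℝ (w v) y) <;> simp
        have h2 : m v * (m v)⁻¹ ≤ 1 := mul_inv_le_one
        calc m v * (|((SignType.sign (inner ℝ (w v) y) : SignType) : ℝ)| * ((m v)⁻¹ * g v))
            = |((SignType.sign (inner ℝ (w v) y) : SignType) : ℝ)| * ((m v * (m v)⁻¹) * g v) := by
              ring
          _ ≤ 1 * (1 * g v) := by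
              gcongr
          _ = g v := by ring
      · rw [hu]
        have := congrArg NNReal.toReal hgs
        push_cast at this
        rw [← this]
        refine Finset.sum_congr rfl fun v _ => ?_
        rw [inner_smul_left, conj_trivial, abs_mul, abs_inv, abs_of_nonneg (hmn v),
          ← sign_mul_self (inner ℝ (w v) y)]
        ring
    · rw [hu]
      calc ∑ v, a v * inner ℝ (w v) y = ∑ v, inner ℝ ((m v)⁻¹ • w v) y * (m v * a v) := by
            refine Finset.sum_congr rfl fun v _ => ?_
            by_cases hv : ν {v} = 0
            · rw [hw0 v hv]; simp
            · rw [inner_smul_left, conj_trivial]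
              have := (hm0 v hv).ne'
              field_simp
        _ ≤ (∑ v, |inner ℝ ((m v)⁻¹ • w v) y| ^ p.toReal) ^ (1 / p.toReal) *
            (∑ v, |m v * a v| ^ q.toReal) ^ (1 / q.toReal) :=
          Real.inner_le_Lp_mul_Lq Finset.univ _ _ hconj
        _ ≤ (∑ v, |inner ℝ ((m v)⁻¹ • w v) y| ^ p.toReal) ^ (1 / p.toReal) * 1 := by
          gcongr
          exact Real.rpow_le_one (Finset.sum_nonneg fun v _ => by positivity) ((hnorm a).1 ha)
            (by positivity)
        _ = _ := mul_one _

end FiniteLp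

/-- Simple functions are dense in `L_q` of a finite measure, for all `1 ≤ q ≤ ∞`. -/
theorem exists_simpleFunc_norm_sub_lt {α : Type*} [MeasurableSpace α] {μ : Measure α}
    [IsFiniteMeasure μ] {q : ℝ≥0∞} [Fact (1 ≤ q)] (h : Lp ℝ q μ) {δ : ℝ} (hδ : 0 < δ) :
    ∃ g : SimpleFunc α ℝ, ‖(g.memLp_of_isFiniteMeasure q μ).toLp g - h‖ < δ := by
  rcases eq_or_ne q ∞ with rfl | hq
  · set M := ‖h‖ with hM
    have hM0 : 0 ≤ M := norm_nonneg _
    have hmeas : Measurable (h : α → ℝ) := (Lp.stronglyMeasurable h).measurable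
    -- For q = ∞: clip h to [-M, M], which changes it only on a null set, and round down to
    -- multiples of δ/2. Clipping everywhere makes the range finite.
    set c := δ / 2 with hc
    have hc0 : 0 < c := by positivity
    set k : α → ℤ := fun x => ⌊max (-M) (min M (h x)) / c⌋ with hk
    have hkm : Measurable k := by
      exact Int.measurable_floor.comp ((measurable_const.max (measurable_const.min hmeas)).div_const c)
    have hkfin : (range k).Finite := by
      refine (Set.finite_Icc ⌊-M / c⌋ ⌊M / c⌋).subset ?_
      rintro _ ⟨x, rfl⟩
      constructor
      · exact Int.floor_le_floor (by gcongr; exact le_max_left _ _)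
      · refine Int.floor_le_floor ?_
        gcongr
        exact max_le (by linarith) (min_le_left _ _)
    let k' : SimpleFunc α ℤ := ⟨k, fun z => hkm (measurableSet_singleton z), hkfin⟩
    let g : SimpleFunc α ℝ := k'.map (fun z : ℤ => (z : ℝ) * c)
    refine ⟨g, ?_⟩
    have hbound : ∀ᵐ x ∂μ, ‖h x‖ ≤ M := by
      have h1 := ae_le_eLpNormEssSup (f := (h : α → ℝ)) (μ := μ)
      filter_upwards [h1] with x hx
      have h2 := ENNReal.toReal_mono (by
        rw [← eLpNorm_exponent_top]; exact Lp.eLpNorm_ne_top h) hx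
      rw [hM, Lp.norm_def, eLpNorm_exponent_top]
      simpa using h2
    have := Lp.norm_le_of_ae_bound (f := (g.memLp_of_isFiniteMeasure ∞ μ).toLp g - h) hc0.le (by
      filter_upwards [hbound, (g.memLp_of_isFiniteMeasure ∞ μ).coeFn_toLp,
        Lp.coeFn_sub ((g.memLp_of_isFiniteMeasure ∞ μ).toLp g) h] with x hx hg hs
      rw [hs, Pi.sub_apply, hg]
      have hgx : g x = (⌊h x / c⌋ : ℝ) * c := by
        change ((k x : ℤ) : ℝ) * c = _
        rw [hk]
        simp only
        rw [Real.norm_eq_abs, abs_le] at hx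
        rw [min_eq_right hx.2, max_eq_right hx.1]
      rw [hgx, Real.norm_eq_abs, abs_le]
      have f1 := Int.floor_le (h x / c)
      have f2 := Int.lt_floor_add_one (h x / c)
      rw [le_div_iff₀ hc0] at f1
      rw [div_lt_iff₀ hc0] at f2
      constructor <;> linarith)
    have h2 : ‖(g.memLp_of_isFiniteMeasure ∞ μ).toLp g - h‖ ≤ c := by simpa using this
    linarith
  · obtain ⟨g, hg, hg'⟩ := (Lp.memLp h).exists_simpleFunc_eLpNorm_sub_lt hq
      (ENNReal.ofReal_pos.2 hδ).ne'
    refine ⟨g, ?_⟩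
    rw [norm_sub_rev]
    have e : h - (g.memLp_of_isFiniteMeasure q μ).toLp g =
        ((Lp.memLp h).sub (g.memLp_of_isFiniteMeasure q μ)).toLp (⇑h - ⇑g) := by
      rw [MemLp.toLp_sub (Lp.memLp h), Lp.toLp_coeFn]
    rw [e, Lp.norm_toLp]
    exact (ENNReal.toReal_lt_of_lt_ofReal hg)

/-- The unit ball of a quotient, up to closure, is the image of the unit ball of the space. -/
theorem exists_continuousLinearMap_of_mem_quotientBalls {n : ℕ} {q : ℝ≥0∞} [Fact (1 ≤ q)]
    {L : Set (E n)} {F : Submodule ℝ (LqSpace q)} (hF : IsClosed (F : Set (LqSpace q)))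
    (e : (LqSpace q ⧸ F) ≃ₗ[ℝ] E n) (hL : L = e '' closedBall (0 : LqSpace q ⧸ F) 1) :
    ∃ u : LqSpace q →L[ℝ] E n, (∀ g, ‖g‖ ≤ 1 → u g ∈ L) ∧
      L ⊆ closure (u '' ball 0 1) ∧ IsCompact L := by
  have : IsClosed (F : Set (LqSpace q)) := hF
  have : FiniteDimensional ℝ (LqSpace q ⧸ F) := e.symm.finiteDimensional
  have hec : Continuous e := LinearMap.continuous_of_finiteDimensional e.toLinearMap
  refine ⟨⟨e.toLinearMap ∘ₗ F.mkQ, hec.comp F.continuous_mkQ⟩, ?_, ?_, ?_⟩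
  · intro g hg
    rw [hL]
    refine ⟨F.mkQ g, ?_, rfl⟩
    rw [mem_closedBall_zero_iff]
    exact (Submodule.Quotient.norm_mk_le F g).trans hg
  -- The quotient norm is an infimum that need not be attained, so only elements of norm below 1 are
  -- lifted into the unit ball.
  · rw [hL, ← closure_ball (0 : LqSpace q ⧸ F) one_ne_zero]
    refine (image_closure_subset_closure_image hec).trans (closure_mono ?_)
    rintro _ ⟨x, hx, rfl⟩
    rw [mem_ball_zero_iff] at hx
    obtain ⟨g, hg, hg'⟩ := Submodule.Quotient.norm_mk_lt x (sub_pos.2 hx)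
    refine ⟨g, ?_, ?_⟩
    · rw [mem_ball_zero_iff]; linarith
    · exact congrArg e hg
  · rw [hL]
    exact (isCompact_closedBall _ _).image hec

/-- The support function of a quotient ball of `L_q` is approximated by `ℓ_p`-sums. -/
theorem exists_lp_approximation {n : ℕ} {p q : ℝ≥0∞} (hpq : 1 / p + 1 / q = 1) (hp : p ≠ ∞)
    {L : Set (E n)} (hL : L ∈ quotientBalls q n) {ε : ℝ} (hε : 0 < ε) :
    ∃ (R : Type) (_ : Fintype R) (f : R → E n), ∀ y : E n,
      (∃ x ∈ L, inner ℝ x y = (∑ v, |inner ℝ (f v) y| ^ p.toReal) ^ (1 / p.toReal)) ∧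
      (∀ x ∈ L, inner ℝ x y ≤
        (∑ v, |inner ℝ (f v) y| ^ p.toReal) ^ (1 / p.toReal) + ε * ‖y‖) := by
  obtain ⟨_, F, hF, e, rfl⟩ := hL
  obtain ⟨u, hu1, hu2, hu3⟩ := exists_continuousLinearMap_of_mem_quotientBalls hF e rfl
  generalize e '' closedBall (0 : LqSpace q ⧸ F) 1 = L at *
  set μ : Measure ℝ := (volume : Measure ℝ).restrict (Icc 0 1) with hμ
  set S : Set (E n) := {x | ∃ g : SimpleFunc ℝ ℝ, ‖(g.memLp_of_isFiniteMeasure q μ).toLp g‖ ≤ 1 ∧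
    u ((g.memLp_of_isFiniteMeasure q μ).toLp g) = x} with hS
  have hSL : S ⊆ L := by
    rintro _ ⟨g, hg, rfl⟩; exact hu1 _ hg
  have hLS : L ⊆ closure S := by
    refine hu2.trans (closure_minimal ?_ isClosed_closure)
    rintro _ ⟨h, hh, rfl⟩
    rw [mem_ball_zero_iff] at hh
    have hcl : h ∈ closure {h' : LqSpace q | u h' ∈ S} := by
      rw [Metric.mem_closure_iff]
      intro δ hδ
      obtain ⟨g, hg⟩ := exists_simpleFunc_norm_sub_lt h (lt_min hδ (sub_pos.2 hh))
      refine ⟨(g.memLp_of_isFiniteMeasure q μ).toLp g, ⟨g, ?_, rfl⟩, ?_⟩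
      · have h1 := norm_sub_norm_le ((g.memLp_of_isFiniteMeasure q μ).toLp g) h
        have h2 := hg.trans_le (min_le_right _ _)
        linarith
      · rw [dist_comm, dist_eq_norm]; exact hg.trans_le (min_le_left _ _)
    exact closure_mono (image_subset_iff.2 fun x hx => hx)
      (image_closure_subset_closure_image u.continuous ⟨h, hcl, rfl⟩)
  -- A finite net comes from finitely many simple functions. Their joint value map `Gt` has finite
  -- range, so all of them factor through one finite measure space, whose L_q embeds isometrically
  -- by `ι`.
  obtain ⟨t, htS, htf, htc⟩ := Metric.finite_approx_of_totallyBounded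
    (hu3.totallyBounded.subset hSL) (ε / 2) (by positivity)
  have htS' : ∀ j : t, ∃ g : SimpleFunc ℝ ℝ, ‖(g.memLp_of_isFiniteMeasure q μ).toLp g‖ ≤ 1 ∧
    u ((g.memLp_of_isFiniteMeasure q μ).toLp g) = j := fun j => htS j.2
  choose G hG1 hG2 using htS'
  have : Fintype t := htf.fintype
  set Gt : ℝ → t → ℝ := fun s j => G j s with hGt
  have hGtfin : (range Gt).Finite := by
    refine (Set.Finite.pi' (t := fun j : t => range (G j)) fun j => (G j).finite_range).subset ?_
    rintro _ ⟨s, rfl⟩ j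
    exact ⟨s, rfl⟩
  have : Fintype (range Gt) := hGtfin.fintype
  have hGtm : Measurable (rangeFactorization Gt) :=
    (measurable_pi_lambda _ fun j => (G j).measurable).subtype_mk
  set ν : Measure (range Gt) := μ.map (rangeFactorization Gt) with hν
  have mp : MeasurePreserving (rangeFactorization Gt) μ ν := ⟨hGtm, rfl⟩
  set ι := Lp.compMeasurePreservingₗᵢ ℝ (E := ℝ) (p := q) _ mp with hι
  obtain ⟨f, hf⟩ := exists_lp_representation (ν := ν) hpq hp (u.toLinearMap ∘ₗ ι.toLinearMap)
  refine ⟨range Gt, inferInstance, f, fun y => ⟨?_, fun x hx => ?_⟩⟩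
  · obtain ⟨a, ha, ha'⟩ := (hf y).1
    refine ⟨_, hu1 (ι (fintypeToLp q ν a)) ?_, ha'⟩
    rw [ι.norm_map]; exact ha
  · obtain ⟨z, hzS, hz⟩ := Metric.mem_closure_iff.1 (hLS hx) (ε / 2) (by positivity)
    obtain ⟨j, hjt, hj⟩ := mem_iUnion₂.1 (htc hzS)
    have hcomp : ι (fintypeToLp q ν (fun v => v.1 ⟨j, hjt⟩)) =
        ((G ⟨j, hjt⟩).memLp_of_isFiniteMeasure q μ).toLp (G ⟨j, hjt⟩) := rfl
    have h1 := (hf y).2 (fun v => v.1 ⟨j, hjt⟩) (by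
      rw [← ι.norm_map, hcomp]; exact hG1 ⟨j, hjt⟩)
    have h2 : inner ℝ j y ≤ (∑ v, |inner ℝ (f v) y| ^ p.toReal) ^ (1 / p.toReal) := by
      have h2 := hG2 ⟨j, hjt⟩
      rw [← hcomp] at h2
      rw [← show u _ = j from h2]; exact h1
    have h3 : inner ℝ (x - j) y ≤ ε * ‖y‖ := by
      refine (real_inner_le_norm _ _).trans ?_
      gcongr
      rw [← dist_eq_norm]
      refine (dist_triangle x z j).trans ?_
      rw [mem_ball] at hj
      linarith
    rw [inner_sub_left] at h3
    linarith

end Discretization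

/-! ### Polar decomposition, traces and mean widths -/

section MeanWidth

variable {n : ℕ}

theorem card_le_sum_of_prod_eq_one {ι : Type*} [Fintype ι] {σ : ι → ℝ} (h0 : ∀ i, 0 < σ i)
    (h : ∏ i, σ i = 1) : (Fintype.card ι : ℝ) ≤ ∑ i, σ i := by
  have h1 : ∑ i, Real.log (σ i) = 0 := by
    rw [← Real.log_prod fun i _ => (h0 i).ne', h, Real.log_one]
  have h2 : ∑ i, Real.log (σ i) ≤ ∑ i, (σ i - 1) :=
    Finset.sum_le_sum fun i _ => Real.log_le_sub_one_of_pos (h0 i)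
  rw [h1, Finset.sum_sub_distrib] at h2
  simp at h2
  linarith

/-- The positive part of the polar decomposition of a volume preserving map, together with its
eigenbasis; its trace is at least the dimension. -/
theorem exists_symmetric_sqrt (T : E n →ₗ[ℝ] E n) (hT : |LinearMap.det T| = 1) :
    ∃ (S : E n →L[ℝ] E n) (b : OrthonormalBasis (Fin n) ℝ (E n)) (σ : Fin n → ℝ),
      (∀ x y, inner ℝ (S x) y = inner ℝ x (S y)) ∧ (∀ y, ‖S y‖ = ‖T y‖) ∧
      (∀ x, inner ℝ x (S x) = ∑ i, σ i * (inner ℝ x (b i)) ^ 2) ∧ (n : ℝ) ≤ ∑ i, σ i := by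
  have hpos := T.isPositive_adjoint_comp_self
  have hsym := hpos.isSymmetric
  have hn : Module.finrank ℝ (E n) = n := finrank_euclideanSpace_fin
  set b := hsym.eigenvectorBasis hn with hb
  set lam := hsym.eigenvalues hn with hlam
  have hlam0 : ∀ i, 0 ≤ lam i := hpos.nonneg_eigenvalues hn
  -- The determinant of T*T is (det T)² = 1.
  have hprod : ∏ i, lam i = 1 := by
    have h1 := T.normDet_sq
    rw [T.normDet_eq_abs_det, hT, hsym.det_eq_prod_eigenvalues hn] at h1
    simpa using h1.symm
  have hlampos : ∀ i, 0 < lam i := fun i => (hlam0 i).lt_of_ne' fun h => by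
    rw [Finset.prod_eq_zero (Finset.mem_univ i) h] at hprod
    exact zero_ne_one hprod
  set σ : Fin n → ℝ := fun i => √(lam i) with hσ
  set S : E n →ₗ[ℝ] E n := ∑ i, σ i • ((innerₗ (E n) (b i)).smulRight (b i)) with hS
  have hSx : ∀ x, S x = ∑ i, (σ i * inner ℝ (b i) x) • b i := by
    intro x
    simp [hS, LinearMap.sum_apply, smul_smul]
  have hSS : ∀ x y, inner ℝ (S x) y = ∑ i, σ i * (inner ℝ (b i) x * inner ℝ (b i) y) := by
    intro x y
    rw [hSx, sum_inner]
    refine Finset.sum_congr rfl fun i _ => ?_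
    rw [inner_smul_left, conj_trivial]; ring
  have hsymS : ∀ x y, inner ℝ (S x) y = inner ℝ x (S y) := by
    intro x y
    rw [hSS, real_inner_comm, hSS]
    exact Finset.sum_congr rfl fun i _ => by ring
  refine ⟨LinearMap.toContinuousLinearMap S, b, σ, hsymS, fun y => ?_, fun x => ?_, ?_⟩
  · have h1 : ‖S y‖ ^ 2 = ∑ i, lam i * inner ℝ (b i) y ^ 2 := by
      rw [← b.sum_sq_norm_inner_right (S y)]
      refine Finset.sum_congr rfl fun i _ => ?_
      have : inner ℝ (b i) (S y) = σ i * inner ℝ (b i) y := by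
        rw [hSx, b.orthonormal.inner_right_fintype]
      rw [this, Real.norm_eq_abs, sq_abs, mul_pow, hσ]
      simp only
      rw [Real.sq_sqrt (hlam0 i)]
    have h2 : ‖T y‖ ^ 2 = ∑ i, lam i * inner ℝ (b i) y ^ 2 := by
      rw [← real_inner_self_eq_norm_sq, ← LinearMap.adjoint_inner_left,
        ← b.sum_inner_mul_inner]
      refine Finset.sum_congr rfl fun i _ => ?_
      have : inner ℝ (LinearMap.adjoint T (T y)) (b i) = lam i * inner ℝ y (b i) := by
        have h3 := hsym y (b i)
        rw [LinearMap.comp_apply] at h3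
        rw [h3, hb, hsym.apply_eigenvectorBasis hn i, inner_smul_right]
        rfl
      rw [this, real_inner_comm y (b i)]; ring
    change ‖S y‖ = ‖T y‖
    rw [← sq_eq_sq₀ (norm_nonneg _) (norm_nonneg _), h1, h2]
  · change inner ℝ x (S x) = _
    rw [real_inner_comm, hSS]
    refine Finset.sum_congr rfl fun i _ => ?_
    rw [real_inner_comm x (b i)]; ring
  · have := card_le_sum_of_prod_eq_one (σ := σ) (fun i => Real.sqrt_pos.2 (hlampos i)) (by
      rw [hσ, Real.sqrt_prod Finset.univ (fun i _ => hlam0 i) |>.symm, hprod, Real.sqrt_one])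
    simpa using this

variable {K : Set (E n)}

/-- In isotropic position, `∫_K ⟨x, S x⟩` is a multiple of the trace of `S`. -/
theorem mul_le_setIntegral_inner (hK : IsSymmConvexBody K) {c : ℝ} (hc0 : 0 ≤ c)
    (hc : ∀ θ ∈ sphere (0 : E n) 1, ∫ x in K, (inner ℝ x θ) ^ 2 = c)
    {S : E n → E n} {b : OrthonormalBasis (Fin n) ℝ (E n)} {σ : Fin n → ℝ}
    (hS : ∀ x, inner ℝ x (S x) = ∑ i, σ i * (inner ℝ x (b i)) ^ 2) (hσ : (n : ℝ) ≤ ∑ i, σ i) :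
    n * c ≤ ∫ x in K, inner ℝ x (S x) := by
  simp only [hS]
  rw [integral_finsetSum _ fun i _ => hK.integrableOn (by fun_prop)]
  have h1 : ∀ i, ∫ x in K, σ i * (inner ℝ x (b i)) ^ 2 = σ i * c := by
    intro i
    rw [integral_const_mul, hc _ (by simp)]
  simp only [h1]
  rw [← Finset.sum_mul]
  gcongr

/-- Boundedness of G makes the set in the infimum defining the gauge nonempty; otherwise the gauge
could take the default value 0. -/
theorem abs_inner_le_gauge_polarBody {G : Set (E n)} {R : ℝ} (hR : 0 < R) (hG : ∀ x ∈ G, ‖x‖ ≤ R)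
    {x : E n} (hx : x ∈ G) (θ : E n) : |inner ℝ x θ| ≤ gauge (polarBody G) θ := by
  rw [gauge]
  refine le_csInf ?_ ?_
  · refine ⟨R * (‖θ‖ + 1), show 0 < R * (‖θ‖ + 1) by positivity, (R * (‖θ‖ + 1))⁻¹ • θ, ?_, ?_⟩
    · intro z hz
      have h1 : |inner ℝ z θ| ≤ R * (‖θ‖ + 1) :=
        (abs_real_inner_le_norm _ _).trans (mul_le_mul (hG z hz) (by linarith) (norm_nonneg _) hR.le)
      change ‖inner ℝ z ((R * (‖θ‖ + 1))⁻¹ • θ)‖ ≤ 1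
      rw [inner_smul_right, Real.norm_eq_abs, abs_mul, abs_inv,
        abs_of_pos (by positivity : 0 < R * (‖θ‖ + 1)), inv_mul_le_iff₀ (by positivity), mul_one]
      exact h1
    · have : R * (‖θ‖ + 1) ≠ 0 := by positivity
      simp only [smul_smul, mul_inv_cancel₀ this, one_smul]
  · rintro r ⟨hr, z, hz, rfl⟩
    have h1 : ‖inner ℝ x z‖ ≤ 1 := hz x hx
    rw [Real.norm_eq_abs] at h1
    have hr' : 0 < r := hr
    change |inner ℝ x (r • z)| ≤ r
    rw [inner_smul_right, abs_mul, abs_of_pos hr']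
    exact mul_le_of_le_one_right hr'.le h1

theorem gauge_polarBody_le {G : Set (E n)} {R : ℝ} (hR : 0 < R) (hG : ∀ x ∈ G, ‖x‖ ≤ R)
    {θ : E n} (hθ : ‖θ‖ = 1) : gauge (polarBody G) θ ≤ R := by
  refine gauge_le_of_mem hR.le ⟨R⁻¹ • θ, ?_, by simp [smul_smul, hR.ne']⟩
  intro z hz
  have h1 : |inner ℝ z θ| ≤ R := by
    refine (abs_real_inner_le_norm _ _).trans ?_
    rw [hθ, mul_one]; exact hG z hz
  change ‖inner ℝ z (R⁻¹ • θ)‖ ≤ 1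
  rw [inner_smul_right, Real.norm_eq_abs, abs_mul, abs_inv, abs_of_pos hR, inv_mul_le_iff₀ hR,
    mul_one]
  exact h1

/-- A function on the sphere that is dominated by the support function of a bounded set `G` has
`L_p` norm at most `M*_p(G)`. -/
theorem eLpNorm_le_meanWidth (hn : 1 ≤ n) {p : ℝ≥0∞} {G : Set (E n)} {R : ℝ} (hR : 0 < R)
    (hG : ∀ x ∈ G, ‖x‖ ≤ R) {h : sphere (0 : E n) 1 → ℝ}
    (hh : ∀ θ, ∃ x ∈ G, |h θ| ≤ |inner ℝ x (θ : E n)|) :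
    eLpNorm h p (sphereProb n) ≤ ENNReal.ofReal (meanWidth p G) := by
  have := isProbabilityMeasure_sphereProb hn
  -- `meanNorm` is a `toReal`, which would send an infinite norm to 0.
  have hfin : eLpNorm (fun θ : sphere (0 : E n) 1 => gauge (polarBody G) (θ : E n)) p
      (sphereProb n) ≠ ∞ := by
    refine ne_top_of_le_ne_top ?_ (eLpNorm_le_of_ae_bound (C := R)
      (Filter.Eventually.of_forall fun θ => ?_))
    · simp
    · rw [Real.norm_eq_abs, abs_of_nonneg (gauge_nonneg _)]
      exact gauge_polarBody_le hR hG (mem_sphere_zero_iff_norm.1 θ.2)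
  rw [meanWidth, meanNorm, ENNReal.ofReal_toReal hfin]
  refine eLpNorm_mono_real fun θ => ?_
  obtain ⟨x, hx, hx'⟩ := hh θ
  exact hx'.trans (abs_inner_le_gauge_polarBody hR hG hx _)

/-- The radius of a bounded set is controlled by its `p`-th mean width for `p ≥ n`. -/
theorem norm_le_mul_meanWidth (hn : 1 ≤ n) {p : ℝ≥0∞} (hp : (n : ℝ≥0∞) ≤ p) {G : Set (E n)}
    {R : ℝ} (hR : 0 < R) (hG : ∀ x ∈ G, ‖x‖ ≤ R) {x : E n} (hx : x ∈ G) :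
    ‖x‖ ≤ 4 ^ 65 * meanWidth p G := by
  have := isProbabilityMeasure_sphereProb hn
  have hn1 : (1 : ℝ) ≤ n := by exact_mod_cast hn
  have hn0 : (n : ℝ≥0∞) ≠ 0 := by exact_mod_cast (by omega : n ≠ 0)
  have hM : 0 ≤ meanWidth p G := ENNReal.toReal_nonneg
  have h1 := eLpNorm_le_meanWidth hn (p := p) hR hG
    (h := fun θ : sphere (0 : E n) 1 => inner ℝ (θ : E n) x) fun θ => ⟨x, hx, by
      rw [real_inner_comm]⟩
  have hcont : Continuous fun θ : sphere (0 : E n) 1 => inner ℝ (θ : E n) x := by fun_prop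
  -- On a probability space the L_n norm is at most the L_p norm, and at exponent n the factor
  -- √(p/n) is 1.
  have h2 := (eLpNorm_le_eLpNorm_of_exponent_le hp
    hcont.aestronglyMeasurable (μ := sphereProb n)).trans h1
  have h3 := ofReal_rpow_le_lintegral_sphere_abs_inner hn x hn1 le_rfl
  rw [eLpNorm_eq_lintegral_rpow_enorm_toReal hn0 (ENNReal.natCast_ne_top n), ENNReal.toReal_natCast,
    one_div, ENNReal.rpow_inv_le_iff (by linarith)] at h2
  have h4 : ∫⁻ θ, ENNReal.ofReal (|inner ℝ (θ : E n) x| ^ (n : ℝ)) ∂(sphereProb n) =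
      ∫⁻ θ, ‖inner ℝ (θ : E n) x‖ₑ ^ (n : ℝ) ∂(sphereProb n) := by
    congr 1; ext θ
    rw [← ENNReal.ofReal_rpow_of_nonneg (abs_nonneg _) (by linarith), ← Real.enorm_eq_ofReal_abs]
  rw [h4] at h3
  have h5 := h3.trans h2
  rw [ENNReal.ofReal_rpow_of_nonneg hM (by linarith), ENNReal.ofReal_le_ofReal_iff (by positivity),
    Real.rpow_le_rpow_iff (by positivity) hM (by linarith), div_self (by linarith), Real.sqrt_one]
    at h5
  have h6 : ((1 / 4 : ℝ) ^ 65) * 4 ^ 65 = 1 := by norm_num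
  calc ‖x‖ = ((1 / 4) ^ 65 * 1 * ‖x‖) * 4 ^ 65 := by
        linear_combination (-‖x‖) * h6
    _ ≤ meanWidth p G * 4 ^ 65 := by gcongr
    _ = _ := mul_comm _ _

/-- The `ℓ_p`-sum of the norms of finitely many vectors is controlled by the `p`-th mean width of
a body whose support function dominates the corresponding `ℓ_p`-sum of linear functionals. -/
theorem sum_norm_rpow_le (hn : 1 ≤ n) {p : ℝ≥0∞} (hp1 : 1 ≤ p) (hpT : p ≠ ∞)
    (hpn : p.toReal ≤ n) {G : Set (E n)} {R : ℝ} (hR : 0 < R) (hG : ∀ x ∈ G, ‖x‖ ≤ R)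
    {ι : Type*} [Fintype ι] (g : ι → E n)
    (hg : ∀ θ : E n, ∃ x ∈ G,
      (∑ v, |inner ℝ (g v) θ| ^ p.toReal) ^ (1 / p.toReal) ≤ |inner ℝ x θ|) :
    ∑ v, ((1 / 4) ^ 65 * √(p.toReal / n) * ‖g v‖) ^ p.toReal ≤ meanWidth p G ^ p.toReal := by
  have hp0 : p ≠ 0 := (zero_lt_one.trans_le hp1).ne'
  have hr1 : 1 ≤ p.toReal := by
    rw [← ENNReal.toReal_one]; exact ENNReal.toReal_mono hpT hp1
  have hr0 : 0 < p.toReal := by linarith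
  have hM : 0 ≤ meanWidth p G := ENNReal.toReal_nonneg
  have hs0 : ∀ θ : E n, 0 ≤ ∑ v, |inner ℝ (g v) θ| ^ p.toReal := fun θ =>
    Finset.sum_nonneg fun v _ => by positivity
  have h1 := eLpNorm_le_meanWidth hn (p := p) hR hG
    (h := fun θ : sphere (0 : E n) 1 =>
      (∑ v, |inner ℝ (g v) (θ : E n)| ^ p.toReal) ^ (1 / p.toReal)) fun θ => by
      obtain ⟨x, hx, hx'⟩ := hg θ
      refine ⟨x, hx, ?_⟩
      rwa [abs_of_nonneg (Real.rpow_nonneg (hs0 _) _)]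
  rw [eLpNorm_eq_lintegral_rpow_enorm_toReal hp0 hpT, one_div, ENNReal.rpow_inv_le_iff hr0] at h1
  have h2 : ∀ θ : sphere (0 : E n) 1,
      ‖(∑ v, |inner ℝ (g v) (θ : E n)| ^ p.toReal) ^ (p.toReal)⁻¹‖ₑ ^ p.toReal =
      ∑ v, ENNReal.ofReal (|inner ℝ (θ : E n) (g v)| ^ p.toReal) := by
    intro θ
    rw [Real.enorm_eq_ofReal (Real.rpow_nonneg (hs0 _) _),
      ENNReal.ofReal_rpow_of_nonneg (Real.rpow_nonneg (hs0 _) _) hr0.le,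
      Real.rpow_inv_rpow (hs0 _) hr0.ne', ENNReal.ofReal_sum_of_nonneg fun v _ => by positivity]
    simp only [real_inner_comm]
  simp only [h2] at h1
  rw [lintegral_finsetSum _ fun v _ => by fun_prop] at h1
  have h3 := (Finset.sum_le_sum fun v _ =>
    ofReal_rpow_le_lintegral_sphere_abs_inner hn (g v) hr1 hpn).trans h1
  rw [← ENNReal.ofReal_sum_of_nonneg fun v _ => by positivity,
    ENNReal.ofReal_rpow_of_nonneg hM hr0.le] at h3
  exact (ENNReal.ofReal_le_ofReal_iff (by positivity)).1 h3

end MeanWidth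

/-! ### The bound for √n·m in the two ranges of p -/

section MainEstimate

variable {n : ℕ} {K : Set (E n)}

theorem setIntegral_inner_sq_eq_mul {c : ℝ}
    (hc : ∀ θ ∈ sphere (0 : E n) 1, ∫ x in K, (inner ℝ x θ) ^ 2 = c) (y : E n) :
    ∫ x in K, (inner ℝ x y) ^ 2 = c * ‖y‖ ^ 2 := by
  rcases eq_or_ne y 0 with rfl | hy
  · simp
  · have hy' : ‖y‖ ≠ 0 := norm_ne_zero_iff.2 hy
    have h1 := hc (‖y‖⁻¹ • y) (by simp [norm_smul, hy'])
    simp only [inner_smul_right, mul_pow] at h1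
    rw [integral_const_mul] at h1
    rw [← h1]
    field_simp

theorem setIntegral_norm_sq_eq_mul (hK : IsSymmConvexBody K) {c : ℝ}
    (hc : ∀ θ ∈ sphere (0 : E n) 1, ∫ x in K, (inner ℝ x θ) ^ 2 = c) :
    ∫ x in K, ‖x‖ ^ 2 = n * c := by
  set b := EuclideanSpace.basisFun (Fin n) ℝ
  have h : ∀ x : E n, ‖x‖ ^ 2 = ∑ i, (inner ℝ x (b i)) ^ 2 := by
    intro x
    rw [← b.sum_sq_norm_inner_left x]
    simp
  simp only [h]
  rw [integral_finsetSum _ fun i _ => hK.integrableOn (by fun_prop),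
    Finset.sum_congr rfl fun i _ => hc (b i) (by simp)]
  simp

/-- Bounding the mean of a `p`-th root by the `p`-th root of the mean. -/
theorem setIntegral_rpow_inv_le {φ : E n → ℝ} (hK : IsSymmConvexBody K) (hφ : Continuous φ)
    (hφ0 : ∀ x, 0 ≤ φ x) {p B : ℝ} (hp : 1 ≤ p) (hB : 0 < B)
    (h : ∫ x in K, φ x ≤ B ^ p * volume.real K) :
    ∫ x in K, φ x ^ (1 / p) ≤ B * volume.real K := by
  have hp0 : 0 < p := by linarith
  have hBp : 0 < B ^ p := Real.rpow_pos_of_pos hB _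
  -- Tangent line of the concave function t ↦ t^(1/p) at t = B^p, obtained from Bernoulli's
  -- inequality.
  have pt : ∀ x, φ x ^ (1 / p) ≤ B / p * (φ x / B ^ p) + B / p * (p - 1) := by
    intro x
    set X := φ x ^ (1 / p) / B with hX
    have hX0 : 0 ≤ X := div_nonneg (Real.rpow_nonneg (hφ0 x) _) hB.le
    have h1 := one_add_mul_self_le_rpow_one_add (s := X - 1) (by linarith) hp
    have h2 : X ^ p = φ x / B ^ p := by
      rw [hX, Real.div_rpow (Real.rpow_nonneg (hφ0 x) _) hB.le, ← Real.rpow_mul (hφ0 x), one_div,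
        inv_mul_cancel₀ hp0.ne', Real.rpow_one]
    rw [add_sub_cancel, h2] at h1
    have h3 : p * X ≤ φ x / B ^ p + (p - 1) := by linarith
    have h4 : φ x ^ (1 / p) = B / p * (p * X) := by rw [hX]; field_simp
    rw [h4, ← mul_add]
    gcongr
  have hc1 : Continuous fun x => φ x ^ (1 / p) :=
    hφ.rpow_const fun x => Or.inr (by positivity)
  calc ∫ x in K, φ x ^ (1 / p)
      ≤ ∫ x in K, (B / p * (φ x / B ^ p) + B / p * (p - 1)) :=
        setIntegral_mono (hK.integrableOn hc1) (hK.integrableOn (by fun_prop)) pt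
    _ = B / p * ((∫ x in K, φ x) / B ^ p) + B / p * (p - 1) * volume.real K := by
        rw [integral_add (hK.integrableOn (by fun_prop)) (hK.integrableOn (by fun_prop)),
          integral_const_mul, integral_div, setIntegral_const, smul_eq_mul, mul_comm (volume.real K)]
    _ ≤ B / p * (B ^ p * volume.real K / B ^ p) + B / p * (p - 1) * volume.real K := by
        gcongr
    _ = B * volume.real K := by field_simp; ring

/-- The first moment of the norm in isotropic position. -/
theorem setIntegral_norm_le (hK : IsSymmConvexBody K) {m : ℝ} (hn : 1 ≤ n) (hm : 0 < m)
    (hc : ∀ θ ∈ sphere (0 : E n) 1, ∫ x in K, (inner ℝ x θ) ^ 2 = m ^ 2 * volume.real K) :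
    ∫ x in K, ‖x‖ ≤ √n * m * volume.real K := by
  have hn0 : (0 : ℝ) < n := by exact_mod_cast hn
  set N := √n * m with hN
  have hN0 : 0 < N := by positivity
  have hN2 : N ^ 2 = n * m ^ 2 := by rw [hN, mul_pow, Real.sq_sqrt hn0.le]
  calc ∫ x in K, ‖x‖ ≤ ∫ x in K, ((2 * N)⁻¹ * ‖x‖ ^ 2 + N / 2) := by
        refine setIntegral_mono (hK.integrableOn (by fun_prop)) (hK.integrableOn (by fun_prop))
          fun x => ?_
        have h1 : 0 ≤ (2 * N)⁻¹ * (‖x‖ - N) ^ 2 := by positivity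
        have h2 : (2 * N)⁻¹ * (‖x‖ - N) ^ 2 = (2 * N)⁻¹ * ‖x‖ ^ 2 + N / 2 - ‖x‖ := by
          field_simp; ring
        show ‖x‖ ≤ (2 * N)⁻¹ * ‖x‖ ^ 2 + N / 2
        linarith
    _ = (2 * N)⁻¹ * (n * (m ^ 2 * volume.real K)) + N / 2 * volume.real K := by
        rw [integral_add (hK.integrableOn (by fun_prop)) (hK.integrableOn (by fun_prop)),
          integral_const_mul, setIntegral_norm_sq_eq_mul hK hc, setIntegral_const, smul_eq_mul,
          mul_comm (volume.real K)]
    _ = N * volume.real K := by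
        rw [← mul_assoc (n : ℝ), ← hN2]; field_simp; ring

theorem isCompact_of_mem_quotientBalls {q : ℝ≥0∞} {L : Set (E n)} (hL : L ∈ quotientBalls q n) :
    IsCompact L := by
  obtain ⟨_, F, hF, e, h⟩ := hL
  exact (exists_continuousLinearMap_of_mem_quotientBalls hF e h).choose_spec.2.2

/-- The estimate for `p ≥ n`. -/
theorem sqrt_mul_le_of_le (hn : 1 ≤ n) (hK : IsSymmConvexBody K) {m : ℝ} (hm : 0 < m)
    (hc : ∀ θ ∈ sphere (0 : E n) 1, ∫ x in K, (inner ℝ x θ) ^ 2 = m ^ 2 * volume.real K)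
    {T : E n →ₗ[ℝ] E n} (hT : |LinearMap.det T| = 1) {M : ℝ} (hM : ∀ x ∈ K, ‖T x‖ ≤ M) :
    √n * m ≤ M := by
  have hV := hK.real_volume_pos
  have hn0 : (0 : ℝ) < n := by exact_mod_cast hn
  obtain ⟨S, b, σ, -, hS2, hS3, hS4⟩ := exists_symmetric_sqrt T hT
  have h1 := mul_le_setIntegral_inner hK (by positivity) hc hS3 hS4
  have hM0 : 0 ≤ M := by
    obtain ⟨x, hx⟩ := hK.nonempty_interior
    exact (norm_nonneg _).trans (hM x (interior_subset hx))
  have h2 : ∫ x in K, inner ℝ x (S x) ≤ ∫ x in K, M * ‖x‖ := by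
    refine setIntegral_mono_on (hK.integrableOn (by fun_prop)) (hK.integrableOn (by fun_prop))
      hK.measurableSet fun x hx => ?_
    refine (real_inner_le_norm _ _).trans ?_
    rw [mul_comm, hS2]
    exact mul_le_mul_of_nonneg_right (hM x hx) (norm_nonneg _)
  rw [integral_const_mul] at h2
  have h3 := h1.trans (h2.trans (mul_le_mul_of_nonneg_left (setIntegral_norm_le hK hn hm hc) hM0))
  have h4 : (√n * m * volume.real K) * (√n * m) ≤ (√n * m * volume.real K) * M := by
    have : (√n * m * volume.real K) * (√n * m) = √n ^ 2 * (m ^ 2 * volume.real K) := by ring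
    rw [this, Real.sq_sqrt hn0.le]
    linarith
  exact le_of_mul_le_mul_left h4 (by positivity)

/-- The estimate for `p ≤ n`. -/
theorem sqrt_mul_le_of_ge (hn : 1 ≤ n) (hK : IsSymmConvexBody K) {m : ℝ} (hm : 0 < m)
    (hc : ∀ θ ∈ sphere (0 : E n) 1, ∫ x in K, (inner ℝ x θ) ^ 2 = m ^ 2 * volume.real K)
    {T : E n →ₗ[ℝ] E n} (hT : |LinearMap.det T| = 1) {p q : ℝ≥0∞} (hp : 1 ≤ p) (hpT : p ≠ ∞)
    (hpn : p.toReal ≤ n) (hpq : 1 / p + 1 / q = 1) {L : Set (E n)} (hL : L ∈ quotientBalls q n)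
    (hKL : K ⊆ L) :
    √n * m ≤ 128 * 4 ^ 65 * √p.toReal * meanWidth p (T '' L) := by
  have hV := hK.real_volume_pos
  have hn0 : (0 : ℝ) < n := by exact_mod_cast hn
  have hr1 : 1 ≤ p.toReal := by
    rw [← ENNReal.toReal_one]; exact ENNReal.toReal_mono hpT hp
  have hr0 : 0 < p.toReal := by linarith
  obtain ⟨S, b, σ, hS1, hS2, hS3, hS4⟩ := exists_symmetric_sqrt T hT
  set r := p.toReal with hr
  set M := meanWidth p (T '' L) with hM
  have hM0 : 0 ≤ M := ENNReal.toReal_nonneg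
  obtain ⟨R, hR0, hR⟩ : ∃ R : ℝ, 0 < R ∧ ∀ x ∈ T '' L, ‖x‖ ≤ R := by
    have hcpt : IsCompact (T '' L) :=
      (isCompact_of_mem_quotientBalls hL).image T.continuous_of_finiteDimensional
    obtain ⟨R, hR⟩ := hcpt.isBounded.exists_norm_le
    exact ⟨max R 1, by positivity, fun x hx => (hR x hx).trans (le_max_left _ _)⟩
  have moment : ∀ y : E n, ∫ x in K, |inner ℝ x y| ^ r ≤ (128 * r * m * ‖y‖) ^ r * volume.real K := by
    intro y
    rcases eq_or_ne y 0 with rfl | hy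
    · simp [Real.zero_rpow hr0.ne']
    · have hy' : 0 < ‖y‖ := norm_pos_iff.2 hy
      have := setIntegral_abs_inner_rpow_le hK y (m := m * ‖y‖) (by positivity) hr1
        (le_of_eq (by rw [setIntegral_inner_sq_eq_mul hc]; ring))
      rwa [← mul_assoc] at this
  -- Only M ≥ 0 is known at this point, while the Jensen step needs a positive bound B; η is removed
  -- at the end.
  have main : ∀ η > 0, √n * m ≤ 128 * 4 ^ 65 * √r * (M + η) := by
    intro η hη
    set κ := 128 * r * m / ((1 / 4) ^ 65 * √(r / n)) with hκ
    have hκ0 : 0 < κ := by positivity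
    set B := κ * (M + η) with hB
    have hB0 : 0 < B := by positivity
    have step : n * (m ^ 2 * volume.real K) ≤ B * volume.real K := by
      refine le_of_forall_pos_le_add fun ε hε => ?_
      set D := ∫ x in K, ‖S x‖ with hD
      have hD0 : 0 ≤ D := integral_nonneg fun x => norm_nonneg _
      -- With this accuracy the error, integrated against |Sx|, is at most ε; the +1 guards against
      -- D = 0.
      obtain ⟨ι, _, f, hf⟩ := exists_lp_approximation hpq hpT hL
        (show 0 < ε / (D + 1) by positivity)
      set φ : E n → ℝ := fun x => ∑ v, |inner ℝ (f v) (S x)| ^ r with hφ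
      have hφc : Continuous φ := by
        refine continuous_finsetSum _ fun v _ => ?_
        exact Continuous.rpow_const (by fun_prop) fun x => Or.inr hr0.le
      have hφ0 : ∀ x, 0 ≤ φ x := fun x => Finset.sum_nonneg fun v _ => by positivity
      have hφint : ∫ x in K, φ x ≤ B ^ r * volume.real K := by
        have e : ∀ v x, |inner ℝ (f v) (S x)| ^ r = |inner ℝ x (S (f v))| ^ r := by
          intro v x
          rw [← hS1, real_inner_comm]
        simp only [hφ, e]
        rw [integral_finsetSum _ fun v _ => hK.integrableOn
          (Continuous.rpow_const (by fun_prop) fun x => Or.inr hr0.le)]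
        refine (Finset.sum_le_sum fun v _ => moment (S (f v))).trans ?_
        rw [← Finset.sum_mul]
        refine mul_le_mul_of_nonneg_right ?_ hV.le
        have hsum := sum_norm_rpow_le hn hp hpT hpn hR0 hR (fun v => T (f v)) fun θ => by
          -- The support function of TL at θ is that of L at T*θ.
          obtain ⟨x, hx, hx'⟩ := (hf (LinearMap.adjoint T θ)).1
          refine ⟨T x, mem_image_of_mem T hx, ?_⟩
          simp only [← LinearMap.adjoint_inner_right]
          rw [← hx']
          exact le_abs_self _
        calc ∑ v, (128 * r * m * ‖S (f v)‖) ^ r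
            = κ ^ r * ∑ v, ((1 / 4) ^ 65 * √(r / n) * ‖T (f v)‖) ^ r := by
              rw [Finset.mul_sum]
              refine Finset.sum_congr rfl fun v _ => ?_
              rw [← Real.mul_rpow hκ0.le (by positivity), hS2]
              congr 1
              have : (1 / 4 : ℝ) ^ 65 * √(r / n) ≠ 0 := by positivity
              rw [hκ, ← mul_assoc, div_mul_cancel₀ _ this]
          _ ≤ κ ^ r * (M + η) ^ r := by
              refine mul_le_mul_of_nonneg_left (hsum.trans ?_) (by positivity)
              exact Real.rpow_le_rpow hM0 (by linarith) hr0.le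
          _ = B ^ r := by rw [hB, Real.mul_rpow hκ0.le (by positivity)]
      have hroot := setIntegral_rpow_inv_le hK hφc hφ0 hr1 hB0 hφint
      have hc1 : Continuous fun x => φ x ^ (1 / r) :=
        hφc.rpow_const fun x => Or.inr (by positivity)
      calc n * (m ^ 2 * volume.real K) ≤ ∫ x in K, inner ℝ x (S x) :=
            mul_le_setIntegral_inner hK (by positivity) hc hS3 hS4
        _ ≤ ∫ x in K, (φ x ^ (1 / r) + ε / (D + 1) * ‖S x‖) := by
            refine setIntegral_mono_on (hK.integrableOn (by fun_prop))
              (hK.integrableOn (hc1.add (by fun_prop))) hK.measurableSet fun x hx => ?_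
            exact (hf (S x)).2 x (hKL hx)
        _ = (∫ x in K, φ x ^ (1 / r)) + ε / (D + 1) * D := by
            rw [integral_add (hK.integrableOn hc1) (hK.integrableOn (by fun_prop)),
              integral_const_mul]
        _ ≤ B * volume.real K + ε := by
            refine add_le_add hroot ?_
            rw [div_mul_eq_mul_div, div_le_iff₀ (by positivity)]
            nlinarith
    rw [← mul_assoc] at step
    have h1 : n * m ^ 2 ≤ B := le_of_mul_le_mul_right step hV
    have h2 : B = √n * m * (128 * 4 ^ 65 * √r * (M + η)) := by
      have hsr : √r ≠ 0 := by positivity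
      have hsn : √(n : ℝ) ≠ 0 := by positivity
      rw [hB, hκ, Real.sqrt_div hr0.le, one_div, inv_pow]
      field_simp
      rw [Real.sq_sqrt hr0.le]
    rw [h2] at h1
    have h3 : (√n * m) * (√n * m) ≤ √n * m * (128 * 4 ^ 65 * √r * (M + η)) := by
      calc (√n * m) * (√n * m) = (√n * √n) * m ^ 2 := by ring
        _ ≤ _ := by rw [Real.mul_self_sqrt hn0.le]; exact h1
    exact le_of_mul_le_mul_left h3 (by positivity)
  refine le_of_forall_pos_le_add fun δ hδ => ?_
  have hA : 0 < 128 * 4 ^ 65 * √r := by positivity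
  have := main (δ / (128 * 4 ^ 65 * √r)) (by positivity)
  rwa [mul_add, mul_div_cancel₀ _ hA.ne'] at this

end MainEstimate

/-! ### Normalization of volume, and nonemptiness of the class -/

section IsotropicConstant

variable {n : ℕ} {K : Set (E n)}

/-- The unit ball contains the cube of side `2 / √n`. -/
theorem inv_sqrt_pow_le_volume_closedBall (hn : 1 ≤ n) :
    ENNReal.ofReal ((√n)⁻¹ ^ n) ≤ volume (closedBall (0 : E n) 1) := by
  have hn0 : (0 : ℝ) < n := by exact_mod_cast hn
  have mp := EuclideanSpace.volume_preserving_symm_measurableEquiv_toLp (Fin n)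
  -- The corner [0, 1/√n]^n of that cube is enough.
  have h1 : volume ((MeasurableEquiv.toLp 2 (Fin n → ℝ)).symm ⁻¹'
      (Set.univ.pi fun _ : Fin n => Icc 0 (√n)⁻¹)) = ENNReal.ofReal ((√n)⁻¹ ^ n) := by
    rw [mp.measure_preimage (MeasurableSet.univ_pi fun _ => measurableSet_Icc).nullMeasurableSet,
      volume_pi_pi, ENNReal.ofReal_pow (by positivity)]
    simp
  rw [← h1]
  refine measure_mono fun x hx => ?_
  have hx' : ∀ i, 0 ≤ x i ∧ x i ≤ (√n)⁻¹ := fun i => hx i (mem_univ i)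
  rw [mem_closedBall_zero_iff, EuclideanSpace.norm_eq, Real.sqrt_le_one]
  calc ∑ i, ‖x i‖ ^ 2 ≤ ∑ _i : Fin n, ((√n)⁻¹) ^ 2 := by
        refine Finset.sum_le_sum fun i _ => ?_
        rw [Real.norm_eq_abs, abs_of_nonneg (hx' i).1]
        exact pow_le_pow_left₀ (hx' i).1 (hx' i).2 2
    _ = 1 := by
        simp [inv_pow, Real.sq_sqrt hn0.le, hn0.ne']

open scoped Pointwise in
/-- The isotropic constant of a body in isotropic position with the volume of the unit ball. -/
theorem isotropicConstant_le (hn : 1 ≤ n) (hK : IsSymmConvexBody K)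
    (hvol : volume K = volume (closedBall (0 : E n) 1)) {m : ℝ} (hm : 0 ≤ m)
    (hc : ∀ θ ∈ sphere (0 : E n) 1, ∫ x in K, (inner ℝ x θ) ^ 2 = m ^ 2 * volume.real K) :
    isotropicConstant K ≤ √n * m := by
  have hV := hK.real_volume_pos
  have hn0 : (0 : ℝ) < n := by exact_mod_cast hn
  have hn' : n ≠ 0 := by omega
  set V := volume.real K with hVdef
  set l : ℝ := V ^ (-(1 / n : ℝ)) with hl
  have hl0 : 0 < l := Real.rpow_pos_of_pos hV _
  have hln : l ^ n = V⁻¹ := by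
    rw [hl, ← Real.rpow_natCast, ← Real.rpow_mul hV.le]
    have : -(1 / n : ℝ) * n = -1 := by field_simp
    rw [this, Real.rpow_neg_one]
  have hl_le : l ≤ √n := by
    have h1 : (√n)⁻¹ ^ n ≤ V := by
      rw [hVdef, measureReal_def, hvol]
      exact (ENNReal.ofReal_le_iff_le_toReal measure_closedBall_lt_top.ne).1
        (inv_sqrt_pow_le_volume_closedBall hn)
    have h2 : l ^ n ≤ √n ^ n := by
      rw [hln]
      refine (inv_anti₀ (by positivity) h1).trans_eq ?_
      rw [inv_pow, inv_inv]
    exact (pow_le_pow_iff_left₀ hl0.le (Real.sqrt_nonneg _) hn').1 h2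
  have himg : (LinearEquiv.smulOfNeZero ℝ (E n) l hl0.ne') '' K = l • K := rfl
  have hmem : l * m ∈ {ℓ : ℝ | 0 ≤ ℓ ∧ ∃ T : E n ≃ₗ[ℝ] E n, volume (T '' K) = 1 ∧
      ∀ θ ∈ sphere (0 : E n) 1, ∫ x in T '' K, (inner ℝ x θ) ^ 2 = ℓ ^ 2} := by
    refine ⟨by positivity, LinearEquiv.smulOfNeZero ℝ (E n) l hl0.ne', ?_, fun θ hθ => ?_⟩
    · rw [himg, Measure.addHaar_smul, finrank_euclideanSpace_fin, abs_of_pos (by positivity), hln,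
        ← ENNReal.ofReal_toReal hK.volume_ne_top, ← ENNReal.ofReal_mul (by positivity)]
      change ENNReal.ofReal (V⁻¹ * V) = 1
      rw [inv_mul_cancel₀ hV.ne', ENNReal.ofReal_one]
    · rw [himg]
      have h1 := Measure.setIntegral_comp_smul_of_pos (volume : Measure (E n))
        (fun x => (inner ℝ x θ) ^ 2) K hl0
      simp only [inner_smul_left, conj_trivial, mul_pow, finrank_euclideanSpace_fin,
        smul_eq_mul] at h1
      rw [integral_const_mul, hc θ hθ, hln, inv_inv] at h1
      have : V * (l * m) ^ 2 = V * ∫ x in l • K, (inner ℝ x θ) ^ 2 := by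
        rw [← h1]; ring
      exact (mul_left_cancel₀ hV.ne' this).symm
  -- An upper bound on the infimum needs one admissible element, so uniqueness of the isotropic
  -- image plays no role.
  refine (csInf_le ⟨0, fun x hx => hx.1⟩ hmem).trans ?_
  gcongr

/-- There are `n` orthonormal functions in `L_2`. -/
theorem exists_orthonormal_L2 (n : ℕ) : ∃ ψ : Fin n → LqSpace 2, Orthonormal ℝ ψ := by
  set A : Fin n → Set ℝ := fun i => Ioc ((i : ℝ) / n) (((i : ℝ) + 1) / n) with hA
  have hAm : ∀ i, MeasurableSet (A i) := fun i => measurableSet_Ioc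
  set μ : Measure ℝ := (volume : Measure ℝ).restrict (Icc 0 1) with hμ
  have hdisj : ∀ i j, i ≠ j → A i ∩ A j = ∅ := by
    intro i j hij
    have hn0 : (0 : ℝ) < n := by exact_mod_cast i.pos
    rw [eq_empty_iff_forall_notMem]
    rintro x ⟨⟨h1, h2⟩, ⟨h3, h4⟩⟩
    have h5 := h1.trans_le h4
    have h6 := h3.trans_le h2
    rw [div_lt_div_iff_of_pos_right hn0] at h5 h6
    norm_cast at h5 h6
    exact hij (Fin.ext (by omega))
  have hvol : ∀ i, μ.real (A i) = 1 / n := by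
    intro i
    have hn0 : (0 : ℝ) < n := by exact_mod_cast i.pos
    have hsub : A i ⊆ Icc 0 1 := by
      rintro x ⟨h1, h2⟩
      have h3 : (0 : ℝ) ≤ (i : ℝ) / n := by positivity
      have h4 : ((i : ℝ) + 1) / n ≤ 1 := by
        rw [div_le_one hn0]; exact_mod_cast i.2
      exact ⟨by linarith, by linarith⟩
    rw [hμ, measureReal_restrict_apply (hAm i), inter_eq_left.2 hsub, hA, Real.volume_real_Ioc]
    have : ((i : ℝ) + 1) / n - i / n = 1 / n := by ring
    rw [this, max_eq_left (by positivity)]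
  -- Disjoint intervals of length 1/n, with height √n to normalize.
  refine ⟨fun i => indicatorConstLp 2 (hAm i) (measure_ne_top μ (A i)) (√n), ?_⟩
  rw [orthonormal_iff_ite]
  intro i j
  have hn0 : (0 : ℝ) < n := by exact_mod_cast i.pos
  have := L2.inner_indicatorConstLp_indicatorConstLp (𝕜 := ℝ) (μ := μ) (hAm i) (hAm j)
    (measure_ne_top μ (A i)) (measure_ne_top μ (A j)) (√n : ℝ) (√n : ℝ)
  refine this.trans ?_
  split_ifs with h
  · subst h
    rw [inter_self, hvol]
    simp [hn0.ne']
  · rw [hdisj i j h]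
    simp

/-- Every bounded set lies in some element of `QL_2^n`. -/
theorem exists_mem_quotientBalls_two (hK : IsCompact K) :
    ∃ L ∈ quotientBalls 2 n, K ⊆ L := by
  obtain ⟨ψ, hψ⟩ := exists_orthonormal_L2 n
  set u : LqSpace 2 →L[ℝ] E n :=
    ∑ i, (innerSL ℝ (ψ i)).smulRight (EuclideanSpace.basisFun (Fin n) ℝ i) with hu
  have hux : ∀ g i, u g i = inner ℝ (ψ i) g := by
    intro g i
    simp [hu, Pi.single_apply]
  have hsurj : Function.Surjective u := by
    intro y
    refine ⟨∑ i, y i • ψ i, ?_⟩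
    ext i
    rw [hux, hψ.inner_right_fintype]
  have hker : IsClosed (LinearMap.ker u.toLinearMap : Set (LqSpace 2)) := u.isClosed_ker
  set F := LinearMap.ker u.toLinearMap
  set e₀ : (LqSpace 2 ⧸ F) ≃ₗ[ℝ] E n := u.toLinearMap.quotKerEquivOfSurjective hsurj
  have : IsClosed (F : Set (LqSpace 2)) := hker
  have hec : Continuous e₀.symm := LinearMap.continuous_of_finiteDimensional e₀.symm.toLinearMap
  obtain ⟨r, hr⟩ := (hK.image hec).isBounded.exists_norm_le
  have hr0 : (0 : ℝ) < max r 1 := by positivity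
  refine ⟨_, ⟨⟨by norm_num⟩, F, hker,
    e₀.trans (LinearEquiv.smulOfNeZero ℝ (E n) (max r 1) hr0.ne'), rfl⟩, fun x hx => ?_⟩
  refine ⟨(max r 1)⁻¹ • e₀.symm x, ?_, ?_⟩
  · rw [mem_closedBall_zero_iff, norm_smul, norm_inv, Real.norm_eq_abs, abs_of_pos hr0,
      inv_mul_le_iff₀ hr0, mul_one]
    exact (hr _ (mem_image_of_mem _ hx)).trans (le_max_left _ _)
  · simp [smul_smul, hr0.ne']

end IsotropicConstant

end IsotropicSlicing

end

/-! ### Combination of the estimates -/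

theorem theorem3 :
    ∃ C : ℝ, 0 < C ∧ ∀ n : ℕ, 1 ≤ n → ∀ K : Set (IsotropicSlicing.E n),
      IsotropicSlicing.IsSymmConvexBody K → IsotropicSlicing.IsIsotropic K →
      volume K = volume (closedBall (0 : IsotropicSlicing.E n) 1) →
      IsotropicSlicing.isotropicConstant K ≤
        C * sInf {m : ℝ | ∃ (p q : ℝ≥0∞) (L : Set (IsotropicSlicing.E n))
          (T : IsotropicSlicing.E n →ₗ[ℝ] IsotropicSlicing.E n),
          1 ≤ q ∧ 1 / p + 1 / q = 1 ∧ L ∈ IsotropicSlicing.quotientBalls q n ∧ K ⊆ L ∧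
          |LinearMap.det T| = 1 ∧
          m = √(min p (n : ℝ≥0∞)).toReal * IsotropicSlicing.meanWidth p (T '' L)} := by
  refine ⟨128 * 4 ^ 65, by positivity, fun n hn K hK ⟨c, hc⟩ hvol => ?_⟩
  have hV := hK.real_volume_pos
  have hn1 : (1 : ℝ) ≤ n := by exact_mod_cast hn
  have hc0 : 0 ≤ c := by
    rw [← hc (EuclideanSpace.single ⟨0, hn⟩ 1) (by simp)]
    exact integral_nonneg fun x => sq_nonneg _
  set m := √(c / volume.real K) with hm
  have hm0 : 0 ≤ m := Real.sqrt_nonneg _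
  have hmc : c = m ^ 2 * volume.real K := by
    rw [hm, Real.sq_sqrt (by positivity), div_mul_cancel₀ _ hV.ne']
  rw [hmc] at hc
  refine (IsotropicSlicing.isotropicConstant_le hn hK hvol hm0 hc).trans ?_
  rw [← div_le_iff₀' (by positivity)]
  refine le_csInf ?_ ?_
  -- The infimum must range over a nonempty set, since the real `sInf` of the empty set is 0; p = q
  -- = 2 and T = id give an element.
  · obtain ⟨L, hL, hKL⟩ := IsotropicSlicing.exists_mem_quotientBalls_two hK.isCompact
    refine ⟨_, 2, 2, L, LinearMap.id, by norm_num, ?_, hL, hKL, by simp, rfl⟩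
    simpa using ENNReal.inv_two_add_inv_two
  · rintro _ ⟨p, q, L, T, hq, hpq, hL, hKL, hT, rfl⟩
    rw [div_le_iff₀' (by positivity)]
    have hM0 : 0 ≤ IsotropicSlicing.meanWidth p (T '' L) := ENNReal.toReal_nonneg
    rcases hm0.eq_or_lt with h0 | hmpos
    · rw [← h0, mul_zero]; positivity
    -- The first case contains p = ∞. Its bound has no factor √n, so √p₀ = √n ≥ 1 only weakens it.
    rcases le_or_gt (n : ℝ≥0∞) p with hnp | hnp
    · obtain ⟨R, hR⟩ := ((IsotropicSlicing.isCompact_of_mem_quotientBalls hL).image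
        T.continuous_of_finiteDimensional).isBounded.exists_norm_le
      have h1 := IsotropicSlicing.sqrt_mul_le_of_le hn hK hmpos hc hT
        (M := 4 ^ 65 * IsotropicSlicing.meanWidth p (T '' L)) fun x hx =>
          IsotropicSlicing.norm_le_mul_meanWidth hn hnp (R := max R 1) (by positivity)
            (fun z hz => (hR z hz).trans (le_max_left _ _)) (mem_image_of_mem T (hKL hx))
      rw [min_eq_right hnp, ENNReal.toReal_natCast]
      refine h1.trans ?_
      have h2 : 1 ≤ √(n : ℝ) := Real.one_le_sqrt.2 hn1
      have h3 := mul_le_mul_of_nonneg_right h2 hM0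
      nlinarith
    · have hp1 : 1 ≤ p := by
        have h1 : 1 / p ≤ 1 := (le_self_add : 1 / p ≤ 1 / p + 1 / q).trans_eq hpq
        rwa [one_div, ENNReal.inv_le_one] at h1
      have hpT : p ≠ ∞ := (hnp.trans (ENNReal.natCast_lt_top n)).ne
      have hpn : p.toReal ≤ n := by
        rw [← ENNReal.toReal_natCast n]
        exact ENNReal.toReal_mono (ENNReal.natCast_ne_top n) hnp.le
      rw [min_eq_left hnp.le, ← mul_assoc]
      exact IsotropicSlicing.sqrt_mul_le_of_ge hn hK hmpos hc hT hp1 hpT hpn hpq hL hKL
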